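/- Let $n>2$ be an integer, let $\Omega\subset\mathbb R^n$ be a bounded domain, and let $\lambda>0$, $0<q<1$, $0<\mu<n$ and $2^*_\mu=\frac{2n-\mu}{n-2}$. Let $H^1_0(\Omega)$ be the closure of $C_c^\infty(\Omega)$ in $H^1(\Omega)$. Consider the problem $$(P_\lambda)\qquad -\Delta u=\lambda u^{-q}+\left(\int_\Omega\frac{|u(x)|^{2^*_\mu}}{|x-y|^{\mu}}\,dx\right)|u(y)|^{2^*_\mu-2}u(y),\quad u>0\ \text{ in }\Omega,\qquad u=0\ \text{ on }\partial\Omega .$$ A positive weak solution of $(P_\lambda)$ is a function $u\in H^1_0(\Omega)$ with $u>0$ almost everywhere in $\Omega$ such that, for every $\psi\in C_c^\infty(\Omega)$, $u^{-q}\psi\in L^1(\Omega)$ and $$\int_\Omega\left(\nabla u\cdot\nabla\psi-\lambda u^{-q}\psi\right)dx-\int_\Omega\int_\Omega\frac{|u(x)|^{2^*_\mu}|u(y)|^{2^*_\mu-2}u(y)\psi(y)}{|x-y|^{\mu}}\,dx\,dy=0 .$$ Then every positive weak solution $u$ of $(P_\lambda)$ belongs to $L^p(\Omega)$ for every $p\in[1,\infty)$.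 -/

import Mathlib

open MeasureTheory Filter Topology
open scoped ContDiff

namespace Choquard

/-- `φ ∈ C_c^∞(Ω)`: a smooth function on `ℝⁿ` whose compact support lies in `Ω`. -/
def IsTestFunction {n : ℕ} (Ω : Set (EuclideanSpace ℝ (Fin n)))
    (φ : EuclideanSpace ℝ (Fin n) → ℝ) : Prop :=
  ContDiff ℝ ∞ φ ∧ HasCompactSupport φ ∧ tsupport φ ⊆ Ω

/-- `G` is the weak (distributional) gradient of `u` on `Ω`:
`∫_Ω u ∂_v φ = - ∫_Ω ⟨G, v⟩ φ` for all directions `v` and all `φ ∈ C_c^∞(Ω)`. -/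
def IsWeakGradient {n : ℕ} (Ω : Set (EuclideanSpace ℝ (Fin n)))
    (u : EuclideanSpace ℝ (Fin n) → ℝ)
    (G : EuclideanSpace ℝ (Fin n) → EuclideanSpace ℝ (Fin n)) : Prop :=
  LocallyIntegrableOn u Ω ∧ LocallyIntegrableOn G Ω ∧
    ∀ φ : EuclideanSpace ℝ (Fin n) → ℝ, IsTestFunction Ω φ →
      ∀ v : EuclideanSpace ℝ (Fin n),
        ∫ x in Ω, u x * fderiv ℝ φ x v = - ∫ x in Ω, inner ℝ (G x) v * φ x

/-- `u ∈ H¹(Ω)` with weak gradient `G` (which is unique almost everywhere in `Ω`). -/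
def MemH1 {n : ℕ} (Ω : Set (EuclideanSpace ℝ (Fin n)))
    (u : EuclideanSpace ℝ (Fin n) → ℝ)
    (G : EuclideanSpace ℝ (Fin n) → EuclideanSpace ℝ (Fin n)) : Prop :=
  MemLp u 2 (volume.restrict Ω) ∧ MemLp G 2 (volume.restrict Ω) ∧ IsWeakGradient Ω u G

/-- `u ∈ H¹₀(Ω)` with weak gradient `G`: `u` is the limit in `H¹(Ω)` of a sequence
in `C_c^∞(Ω)`. -/
def MemH10 {n : ℕ} (Ω : Set (EuclideanSpace ℝ (Fin n)))
    (u : EuclideanSpace ℝ (Fin n) → ℝ)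
    (G : EuclideanSpace ℝ (Fin n) → EuclideanSpace ℝ (Fin n)) : Prop :=
  MemH1 Ω u G ∧
    ∃ φ : ℕ → EuclideanSpace ℝ (Fin n) → ℝ,
      (∀ k, IsTestFunction Ω (φ k)) ∧
      Tendsto (fun k => eLpNorm (fun x => φ k x - u x) 2 (volume.restrict Ω)) atTop (𝓝 0) ∧
      Tendsto (fun k => eLpNorm (fun x => gradient (φ k) x - G x) 2 (volume.restrict Ω))
        atTop (𝓝 0)

/-- The upper critical exponent `2^*_μ = (2n - μ)/(n - 2)`. -/
noncomputable def critExp (n : ℕ) (mu : ℝ) : ℝ := (2 * (n : ℝ) - mu) / ((n : ℝ) - 2)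

/-- `u` is a positive weak solution in `Ω` of
`-Δu = λ u^{-q} + (∫_Ω |u(x)|^{2^*_μ} |x-y|^{-μ} dx) |u|^{2^*_μ-2} u`, `u > 0` in `Ω`,
`u = 0` on `∂Ω`. The integrability of `u^{-q} ψ`, without which the weak formulation has no
meaning, is part of the definition. (For `u ∈ H¹₀(Ω)` the double integral always converges
absolutely, by the Hardy-Littlewood-Sobolev and Sobolev inequalities.) -/
def IsPositiveWeakSolution {n : ℕ} (Ω : Set (EuclideanSpace ℝ (Fin n))) (lam q mu : ℝ)
    (u : EuclideanSpace ℝ (Fin n) → ℝ) : Prop :=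
  (∀ᵐ x ∂(volume.restrict Ω), 0 < u x) ∧
  ∃ G : EuclideanSpace ℝ (Fin n) → EuclideanSpace ℝ (Fin n),
    MemH10 Ω u G ∧
    ∀ ψ : EuclideanSpace ℝ (Fin n) → ℝ, IsTestFunction Ω ψ →
      IntegrableOn (fun x => u x ^ (-q) * ψ x) Ω ∧
      (∫ x in Ω, (inner ℝ (G x) (gradient ψ x) - lam * u x ^ (-q) * ψ x))
        - (∫ y in Ω, ∫ x in Ω,
            |u x| ^ critExp n mu * |u y| ^ (critExp n mu - 2) * u y * ψ y / ‖x - y‖ ^ mu)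
        = 0

end Choquard

set_option linter.unusedSectionVars false

/-! The singular term is harmful only where u is small, and high integrability concerns only the set
where u is large. So the equation is replaced by a differential inequality for a function that
differs from u by a bounded amount. Its right-hand side is λ + N, where N = (|x|^{-μ} * u^p) u^{p-1}
and p = 2^*_μ; N is integrable by the Hardy–Littlewood–Sobolev and Sobolev inequalities.

Let c(t) = t²/(1+t²), so that t^{-q} c(t) ≤ 1 for t > 0. Testing the equation with ζ c(φ_k), where
φ_k → u in H¹ are test functions, and dropping the nonnegative term ζ c'(u)|∇u|² gives ∫ c(u) ∇u·∇ζ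
≤ ∫ (λ+N) ζ for ζ ≥ 0 (`integral_cutoff_mul_inner_le`). A second factor c(φ_k) supplies the compact
support, so that ζ may be replaced by any smooth ψ ≥ 0 on ℝⁿ (`integral_cutoff_sq_mul_inner_le`).
Thus w = P(u), with P' = c² and P(0) = 0, satisfies -Δw ≤ λ+N across the boundary, with no
regularity of Ω required. Taking for ψ the regularised fundamental solution and letting ε → 0 at
Lebesgue points gives w ≤ C |x|^{2-n} * (λ+N) almost everywhere (`exists_ae_ofReal_le_rieszPot`).
Since u ≤ 3 + w, this yields the integral inequality u ≤ C₀ + C |x|^{2-n} * N.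

The rest uses only Riesz potentials of nonnegative functions. Splitting u^p ≤ M^p + H u with H =
u^{p-1} 1_{u>M} turns the inequality into u ≤ g + Tu. Here T is a positive linear operator which,
for M large, is a contraction both on L^{2n/(n-2)} and on L^r for r somewhat larger, so u ∈ L^r
(`lrNorm_ne_top_of_le_add`, `lrNorm_ne_top_of_le_choquard`). The gain makes |x|^{-μ} * u^p bounded.
What remains has power p-1 < (n+2)/(n-2), and a finite bootstrap reaches every exponent
(`lrNorm_ne_top_of_le_rieszPot_rpow`). -/

namespace Choquard

/-! ### Riesz kernels: scaling, and integrability near the origin and at infinity. -/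

section Riesz

open Set Metric Module
open scoped ENNReal

variable {E : Type*} [NormedAddCommGroup E] [NormedSpace ℝ E] [FiniteDimensional ℝ E]
  [MeasureSpace E] [BorelSpace E]

/-- The Riesz kernel `‖z‖^{-a}`. -/
noncomputable def rieszKernel (a : ℝ) (z : E) : ℝ≥0∞ := ENNReal.ofReal (‖z‖ ^ (-a))

/-- The (unnormalised) Riesz potential `∫ f(y) ‖x - y‖^{-a} dy`. -/
noncomputable def rieszPot (a : ℝ) (f : E → ℝ≥0∞) (x : E) : ℝ≥0∞ :=
  ∫⁻ y, f y * rieszKernel a (x - y)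

theorem measurable_rieszKernel (a : ℝ) : Measurable (rieszKernel a : E → ℝ≥0∞) := by
  unfold rieszKernel; fun_prop

theorem measurable_rieszPot [(volume : Measure E).IsAddHaarMeasure] (a : ℝ) {f : E → ℝ≥0∞}
    (hf : Measurable f) :
    Measurable (rieszPot a f) := by
  have : ProperSpace E := FiniteDimensional.proper_real E
  exact Measurable.lintegral_prod_right' (f := fun p : E × E => f p.2 * rieszKernel a (p.1 - p.2))
    ((hf.comp measurable_snd).mul ((measurable_rieszKernel a).comp (measurable_fst.sub measurable_snd)))

theorem rieszPot_mono (a : ℝ) {f g : E → ℝ≥0∞} (h : f ≤ᵐ[volume] g) (x : E) :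
    rieszPot a f x ≤ rieszPot a g x := by
  refine lintegral_mono_ae ?_
  filter_upwards [h] with y hy
  gcongr

variable [(volume : Measure E).IsAddHaarMeasure]

theorem lintegral_comp_smul_eq {R : ℝ} (hR : 0 < R) {F : E → ℝ≥0∞} (hF : Measurable F) :
    ∫⁻ z, F z = ENNReal.ofReal (R ^ (finrank ℝ E : ℝ)) * ∫⁻ z, F (R • z) := by
  have h1 : ∫⁻ z, F (R • z) = ∫⁻ z, F z ∂(Measure.map (R • ·) volume) :=
    (lintegral_map hF (measurable_const_smul R)).symm
  rw [h1, Measure.map_addHaar_smul volume hR.ne', lintegral_smul_measure, smul_eq_mul, ← mul_assoc,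
    ← ENNReal.ofReal_mul (by positivity), Real.rpow_natCast, abs_of_pos (by positivity),
    mul_inv_cancel₀ (by positivity)]
  simp

/-- The dilation z ↦ R z contributes R^d from the volume and R^{-a} from the homogeneous kernel.
Balls and their complements are the two cases needed. -/
theorem setLIntegral_rieszKernel_smul {R a : ℝ} (hR : 0 < R) {s t : Set E} (hs : MeasurableSet s)
    (ht : MeasurableSet t) (hst : ∀ z, R • z ∈ s ↔ z ∈ t) :
    ∫⁻ z in s, rieszKernel a z
      = ENNReal.ofReal (R ^ ((finrank ℝ E : ℝ) - a)) * ∫⁻ z in t, rieszKernel a z := by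
  have h2 : ∀ z : E, s.indicator (rieszKernel a) (R • z)
      = ENNReal.ofReal (R ^ (-a)) * t.indicator (rieszKernel a) z := by
    intro z
    by_cases hz : z ∈ t
    · rw [indicator_of_mem hz, indicator_of_mem ((hst z).2 hz), rieszKernel, rieszKernel, norm_smul,
        ← ENNReal.ofReal_mul (by positivity), Real.norm_of_nonneg hR.le,
        Real.mul_rpow hR.le (norm_nonneg _)]
    · rw [indicator_of_notMem hz, indicator_of_notMem (fun h => hz ((hst z).1 h)), mul_zero]
  rw [← lintegral_indicator hs, ← lintegral_indicator ht,
    lintegral_comp_smul_eq hR ((measurable_rieszKernel a).indicator hs)]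
  simp_rw [h2]
  rw [lintegral_const_mul _ ((measurable_rieszKernel a).indicator ht), ← mul_assoc,
    ← ENNReal.ofReal_mul (by positivity), ← Real.rpow_add hR, sub_eq_add_neg]

theorem setLIntegral_ball_rieszKernel {R a : ℝ} (hR : 0 < R) :
    ∫⁻ z in ball (0 : E) R, rieszKernel a z
      = ENNReal.ofReal (R ^ ((finrank ℝ E : ℝ) - a)) * ∫⁻ z in ball (0 : E) 1, rieszKernel a z :=
  setLIntegral_rieszKernel_smul hR measurableSet_ball measurableSet_ball (fun z => by
    simp [norm_smul, abs_of_pos hR, hR])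

theorem setLIntegral_compl_ball_rieszKernel {R a : ℝ} (hR : 0 < R) :
    ∫⁻ z in (ball (0 : E) R)ᶜ, rieszKernel a z
      = ENNReal.ofReal (R ^ ((finrank ℝ E : ℝ) - a)) * ∫⁻ z in (ball (0 : E) 1)ᶜ, rieszKernel a z :=
  setLIntegral_rieszKernel_smul hR measurableSet_ball.compl measurableSet_ball.compl (fun z => by
    simp [norm_smul, abs_of_pos hR, hR])

theorem setLIntegral_ball_rieszKernel_ne_top (hd : 1 ≤ finrank ℝ E) {a : ℝ} (R : ℝ)
    (ha : a < finrank ℝ E) : ∫⁻ z in ball (0 : E) R, rieszKernel a z ≠ ⊤ := by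
  have h : IntegrableOn (fun z : E => ‖z‖ ^ (-a)) (ball 0 R) := by
    refine integrableOn_ball_of_norm_le_rpow hd (C := 1) ha (Eventually.of_forall fun x => ?_) ?_
    · simp [abs_of_nonneg (Real.rpow_nonneg (norm_nonneg x) (-a))]
    · exact (by fun_prop : Measurable fun z : E => ‖z‖ ^ (-a)).aestronglyMeasurable
  have := h.lintegral_lt_top.ne
  exact this

theorem setLIntegral_compl_ball_rieszKernel_ne_top (hd : 1 ≤ finrank ℝ E) {a : ℝ}
    (ha : (finrank ℝ E : ℝ) < a) : ∫⁻ z in (ball (0 : E) 1)ᶜ, rieszKernel a z ≠ ⊤ := by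
  have : Nontrivial E := Module.nontrivial_of_finrank_pos (R := ℝ) (by omega)
  have h : Integrable (fun z : E => (Ici (1 : ℝ)).indicator (fun t => t ^ (-a)) ‖z‖) := by
    rw [integrable_fun_norm_addHaar volume (f := (Ici (1 : ℝ)).indicator (fun t => t ^ (-a)))]
    -- Polar coordinates have reduced the claim to a power on the closed half-line [1, ∞). Starting
    -- at 1/2 makes the open half-line contain it.
    have h1 : IntegrableOn (fun y : ℝ => y ^ ((finrank ℝ E : ℝ) - 1 - a)) (Ioi (1 / 2)) :=
      integrableOn_Ioi_rpow_of_lt (by linarith) (by norm_num)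
    refine Integrable.mono' (g := (Ici (1 : ℝ)).indicator
      (fun y : ℝ => y ^ ((finrank ℝ E : ℝ) - 1 - a))) ?_ ?_ ?_
    · refine Integrable.mono_measure ?_ Measure.restrict_le_self
      rw [integrable_indicator_iff measurableSet_Ici]
      exact h1.mono_set (fun x (hx : 1 ≤ x) => show (1 / 2 : ℝ) < x by linarith)
    · have h3 : Measurable ((Ici (1 : ℝ)).indicator (fun t => t ^ (-a))) :=
        (by fun_prop : Measurable fun t : ℝ => t ^ (-a)).indicator measurableSet_Ici
      exact ((by fun_prop : Measurable fun y : ℝ => y ^ (finrank ℝ E - 1)).mul h3).aestronglyMeasurable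
    · refine Eventually.of_forall fun y => ?_
      by_cases hy : y ∈ Ici (1 : ℝ)
      · have hy0 : 0 < y := lt_of_lt_of_le one_pos hy
        rw [indicator_of_mem hy, indicator_of_mem hy, smul_eq_mul, ← Real.rpow_natCast,
          ← Real.rpow_add hy0, Real.norm_of_nonneg (by positivity)]
        push_cast [Nat.cast_sub hd]
        rw [sub_eq_add_neg _ a]
      · rw [indicator_of_notMem hy, indicator_of_notMem hy]; simp
  have h2 := h.lintegral_lt_top.ne
  rw [← lintegral_indicator measurableSet_ball.compl]
  convert h2 using 2
  ext z
  by_cases hz : z ∈ (ball (0 : E) 1)ᶜ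
  · have : ‖z‖ ∈ Ici (1 : ℝ) := by simpa using hz
    rw [indicator_of_mem hz, indicator_of_mem this, rieszKernel]
  · have : ‖z‖ ∉ Ici (1 : ℝ) := by simpa using hz
    rw [indicator_of_notMem hz, indicator_of_notMem this]; simp

end Riesz

/-! ### The Hardy–Littlewood–Sobolev inequality, by truncation and layer cake. -/

section HardyLittlewoodSobolev

open Set Metric Module
open scoped ENNReal

/-- The layer-cake identity ∫₀^G t^{e-1} dt = G^e / e, including G = ∞, since potentials may take
infinite values. -/
theorem setLIntegral_Ioi_indicator_rpow {e : ℝ} (he : 0 < e) (G : ℝ≥0∞) :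
    ∫⁻ t in Ioi (0 : ℝ), {t : ℝ | ENNReal.ofReal t < G}.indicator
      (fun t => ENNReal.ofReal (t ^ (e - 1))) t = G ^ e / ENNReal.ofReal e := by
  have hset : ∀ G : ℝ≥0∞, MeasurableSet {t : ℝ | ENNReal.ofReal t < G} := fun G =>
    measurableSet_lt ENNReal.measurable_ofReal measurable_const
  have hfin : ∀ b : ℝ, 0 ≤ b → ∫⁻ t in Ioi (0 : ℝ), {t : ℝ | ENNReal.ofReal t < ENNReal.ofReal b}.indicator
      (fun t => ENNReal.ofReal (t ^ (e - 1))) t = ENNReal.ofReal b ^ e / ENNReal.ofReal e := by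
    intro b hb
    rw [setLIntegral_indicator (hset _)]
    have hs : {t : ℝ | ENNReal.ofReal t < ENNReal.ofReal b} ∩ Ioi 0 = Ioo 0 b := by
      ext t
      simp only [mem_inter_iff, mem_ofPred_eq, mem_Ioi, mem_Ioo]
      constructor
      · rintro ⟨h1, h2⟩
        exact ⟨h2, (ENNReal.ofReal_lt_ofReal_iff_of_nonneg h2.le).1 h1⟩
      · rintro ⟨h1, h2⟩
        exact ⟨(ENNReal.ofReal_lt_ofReal_iff_of_nonneg h1.le).2 h2, h1⟩
    rw [hs]
    rcases hb.eq_or_lt with rfl | hb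
    · simp [he]
    have hint : IntegrableOn (fun t : ℝ => t ^ (e - 1)) (Ioo 0 b) := by
      rw [intervalIntegral.integrableOn_Ioo_rpow_iff hb]; linarith
    rw [← ofReal_integral_eq_lintegral_ofReal hint
      ((ae_restrict_iff' measurableSet_Ioo).2 (Eventually.of_forall fun t ht =>
        Real.rpow_nonneg ht.1.le _)), ← integral_Ioc_eq_integral_Ioo,
      ← intervalIntegral.integral_of_le hb.le, integral_rpow (Or.inl (by linarith))]
    rw [sub_add_cancel, Real.zero_rpow he.ne', sub_zero, ENNReal.ofReal_div_of_pos he,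
      ENNReal.ofReal_rpow_of_nonneg hb.le he.le]
  by_cases hG : G = ⊤
  · subst hG
    rw [ENNReal.top_rpow_of_pos he, ENNReal.top_div_of_ne_top ENNReal.ofReal_ne_top]
    refine ENNReal.eq_top_of_forall_nnreal_le fun r => ?_
    -- The endpoint is chosen so that the finite case gives exactly r; hence the integral up to ∞ is
    -- at least every r.
    have h0 : (0 : ℝ) ≤ (r * e) ^ (1 / e) := by positivity
    have h1 := hfin ((r * e) ^ (1 / e)) h0
    rw [ENNReal.ofReal_rpow_of_nonneg h0 he.le, ← Real.rpow_mul (by positivity), one_div,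
      inv_mul_cancel₀ he.ne', Real.rpow_one, ← ENNReal.ofReal_div_of_pos he,
      mul_div_cancel_right₀ _ he.ne', ENNReal.ofReal_coe_nnreal] at h1
    rw [← h1]
    refine lintegral_mono fun t => ?_
    refine indicator_le_indicator_of_subset (fun t _ => ?_) (fun _ => zero_le) t
    exact (ENNReal.ofReal_lt_top : ENNReal.ofReal t < ⊤)
  · rw [← ENNReal.ofReal_toReal hG]
    exact hfin _ ENNReal.toReal_nonneg

variable {E : Type*} [NormedAddCommGroup E] [NormedSpace ℝ E] [FiniteDimensional ℝ E]
  [MeasureSpace E] [BorelSpace E] [(volume : Measure E).IsAddHaarMeasure]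

theorem rieszKernel_rpow (a : ℝ) {c : ℝ} (hc : 0 ≤ c) (z : E) :
    rieszKernel a z ^ c = rieszKernel (a * c) z := by
  rw [rieszKernel, rieszKernel, ENNReal.ofReal_rpow_of_nonneg (by positivity) hc,
    ← Real.rpow_mul (norm_nonneg _)]
  congr 2; ring

/-- Hölder's inequality: outside the ball of radius R the kernel has L^{r'} norm proportional to
R^{d/r' - a} = R^{-d/s}. The radius R = t^{-s/d} is the one that makes this proportional to t. -/
theorem lintegral_mul_indicator_compl_ball_le (hd : 1 ≤ finrank ℝ E) {a r s : ℝ} (hr : 1 < r)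
    (hs : 0 < s) (h : 1 / s = 1 / r - (finrank ℝ E - a) / finrank ℝ E) :
    ∃ B : ℝ≥0∞, B ≠ ⊤ ∧ ∀ f : E → ℝ≥0∞, Measurable f → ∫⁻ y, f y ^ r ≤ 1 → ∀ t > 0, ∀ x,
      ∫⁻ y, f y * (ball (0 : E) (t ^ (-s / finrank ℝ E)))ᶜ.indicator (rieszKernel a) (x - y)
        ≤ ENNReal.ofReal t * B := by
  set d : ℝ := (finrank ℝ E : ℝ) with hd_def
  have hdp : 0 < d := by rw [hd_def]; exact_mod_cast hd
  have hconj := Real.HolderConjugate.conjExponent hr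
  set r' := Real.conjExponent r with hr'
  have hr'0 : 0 < r' := hconj.symm.pos
  have hrr : 1 / r' = 1 - 1 / r := by
    have := hconj.inv_add_inv_eq_one
    simp only [one_div]; linarith
  have hexp : d / r' - a = - (d / s) := by
    have e1 : d / r' = d * (1 - 1 / r) := by rw [← hrr]; ring
    have e2 : d / s = d * (1 / r - (d - a) / d) := by rw [← h]; ring
    rw [e1, e2]; field_simp; ring
  have har : d < a * r' := by
    have : 0 < d / s := by positivity
    have h1 : d / r' < a := by linarith
    rwa [div_lt_iff₀ hr'0] at h1
  have hfin := setLIntegral_compl_ball_rieszKernel_ne_top (E := E) hd har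
  refine ⟨(∫⁻ z in (ball (0 : E) 1)ᶜ, rieszKernel (a * r') z) ^ (1 / r'),
    ENNReal.rpow_ne_top_of_nonneg (by positivity) hfin, fun f hf hf1 t ht x => ?_⟩
  set R := t ^ (-s / d) with hR
  have hRp : 0 < R := by positivity
  have hk : Measurable fun y : E => (ball (0 : E) R)ᶜ.indicator (rieszKernel a) (x - y) :=
    ((measurable_rieszKernel a).indicator measurableSet_ball.compl).comp (measurable_const.sub measurable_id)
  have H := ENNReal.lintegral_mul_le_Lp_mul_Lq (volume : Measure E) hconj hf.aemeasurable hk.aemeasurable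
  refine H.trans ?_
  have h1 : (∫⁻ y, f y ^ r) ^ (1 / r) ≤ 1 := ENNReal.rpow_le_one hf1 (by positivity)
  have h2 : ∫⁻ y, (ball (0 : E) R)ᶜ.indicator (rieszKernel a) (x - y) ^ r'
      = ENNReal.ofReal (R ^ (d - a * r')) * ∫⁻ z in (ball (0 : E) 1)ᶜ, rieszKernel (a * r') z := by
    rw [← setLIntegral_compl_ball_rieszKernel hRp, ← lintegral_indicator measurableSet_ball.compl,
      ← lintegral_sub_left_eq_self ((ball (0 : E) R)ᶜ.indicator (rieszKernel (a * r'))) x]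
    refine lintegral_congr fun y => ?_
    by_cases hz : x - y ∈ (ball (0 : E) R)ᶜ
    · rw [indicator_of_mem hz, indicator_of_mem hz, rieszKernel_rpow a hr'0.le]
    · rw [indicator_of_notMem hz, indicator_of_notMem hz, ENNReal.zero_rpow_of_pos hr'0]
  rw [h2, ENNReal.mul_rpow_of_nonneg _ _ (by positivity),
    ENNReal.ofReal_rpow_of_nonneg (by positivity) (by positivity), ← Real.rpow_mul hRp.le,
    hR, ← Real.rpow_mul ht.le]
  have h3 : -s / d * ((d - a * r') * (1 / r')) = 1 := by
    have : (d - a * r') * (1 / r') = d / r' - a := by field_simp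
    rw [this, hexp]; field_simp
  rw [h3, Real.rpow_one]
  exact (mul_le_mul_left h1 _).trans_eq (one_mul _)

theorem lintegral_indicator_ball_sub {a R : ℝ} (hR : 0 < R) (x : E) :
    ∫⁻ y, (ball (0 : E) R).indicator (rieszKernel a) (x - y)
      = ENNReal.ofReal (R ^ (finrank ℝ E - a)) * ∫⁻ z in ball (0 : E) 1, rieszKernel a z := by
  rw [← setLIntegral_ball_rieszKernel hR, ← lintegral_indicator measurableSet_ball]
  exact lintegral_sub_left_eq_self _ x

/-- Both the kernel and f are truncated at scales depending on t. The far kernel and the low part of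
f contribute at most a multiple of t, so the potential can exceed K t only through the high part of
f near x. That piece is estimated in L¹ by Tonelli and Chebyshev. Keeping the truncated integral of
f on the right, instead of a weak-type bound, lets the strong inequality follow by integrating in t.
-/
theorem measure_lt_rieszPot_le (hd : 1 ≤ finrank ℝ E) {a r s : ℝ}
    (had : a < finrank ℝ E)
    (hr : 1 < r) (hs : 0 < s) (h : 1 / s = 1 / r - (finrank ℝ E - a) / finrank ℝ E) :
    ∃ A K : ℝ≥0∞, A ≠ ⊤ ∧ K ≠ ⊤ ∧ K ≠ 0 ∧ ∀ f : E → ℝ≥0∞, Measurable f → ∫⁻ y, f y ^ r ≤ 1 →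
      ∀ t > 0, volume {x | ENNReal.ofReal t < rieszPot a f x / K}
        ≤ A * ENNReal.ofReal (t ^ (-(s / r)))
          * ∫⁻ y, {y | ENNReal.ofReal (t ^ (s / r)) < f y}.indicator f y := by
  obtain ⟨B, hB, hfar⟩ := lintegral_mul_indicator_compl_ball_le (E := E) hd hr hs h
  set d : ℝ := (finrank ℝ E : ℝ) with hd_def
  have hdp : 0 < d := by rw [hd_def]; exact_mod_cast hd
  set A : ℝ≥0∞ := ∫⁻ z in ball (0 : E) 1, rieszKernel a z with hA_def
  have hA : A ≠ ⊤ := setLIntegral_ball_rieszKernel_ne_top hd 1 had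
  have hK : A + B + 1 ≠ ⊤ := by finiteness
  -- A and B account for the low and far pieces; the extra 1 leaves t itself to be exceeded by the
  -- remaining piece.
  refine ⟨A, A + B + 1, hA, hK, by simp, fun f hf hf1 t ht => ?_⟩
  have hps : ProperSpace E := FiniteDimensional.proper_real E
  -- Height τ for f and radius R for the kernel are balanced so that τ R^{d-a} = t.
  set τ : ℝ := t ^ (s / r) with hτ
  set R : ℝ := t ^ (-s / d) with hR
  have hRp : 0 < R := by positivity
  have hexp : R ^ (d - a) = t * t ^ (-(s / r)) := by
    have e0 : t * t ^ (-(s / r)) = t ^ (1 + -(s / r)) := by rw [Real.rpow_add ht, Real.rpow_one]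
    rw [e0, hR, ← Real.rpow_mul ht.le]
    congr 1
    have e1 : -s / d * (d - a) = - s * ((d - a) / d) := by field_simp
    have e2 : (d - a) / d = 1 / r - 1 / s := by linarith
    rw [e1, e2]; field_simp; ring
  have hsm : MeasurableSet {y | ENNReal.ofReal τ < f y} := measurableSet_lt measurable_const hf
  set F := {y | ENNReal.ofReal τ < f y}.indicator f with hF
  have hFm : Measurable F := hf.indicator hsm
  set k := (ball (0 : E) R).indicator (rieszKernel a) with hk
  have hkm : Measurable k := (measurable_rieszKernel a).indicator measurableSet_ball
  have hkx : ∀ x, Measurable fun y => k (x - y) := fun x =>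
    hkm.comp (measurable_const.sub measurable_id)
  set g : E → ℝ≥0∞ := fun x => ∫⁻ y, F y * k (x - y) with hg
  have hgm : Measurable g :=
    Measurable.lintegral_prod_right' (f := fun p : E × E => F p.2 * k (p.1 - p.2))
      ((hFm.comp measurable_snd).mul (hkm.comp (measurable_fst.sub measurable_snd)))
  have hbound : ∀ x, rieszPot a f x ≤ (A + B) * ENNReal.ofReal t + g x := by
    intro x
    have h1 : ∀ y, f y * rieszKernel a (x - y) ≤ (ENNReal.ofReal τ * k (x - y) + F y * k (x - y))
        + f y * (ball (0 : E) R)ᶜ.indicator (rieszKernel a) (x - y) := by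
      intro y
      by_cases hz : x - y ∈ ball (0 : E) R
      · refine le_trans ?_ (le_add_of_nonneg_right (zero_le))
        rw [hk, indicator_of_mem hz]
        by_cases hy : ENNReal.ofReal τ < f y
        · refine le_trans ?_ (le_add_of_nonneg_left (zero_le))
          rw [hF, indicator_of_mem (show y ∈ {y | ENNReal.ofReal τ < f y} from hy)]
        · refine le_trans ?_ (le_add_of_nonneg_right (zero_le))
          gcongr; exact not_lt.1 hy
      · refine le_trans ?_ (le_add_of_nonneg_left (zero_le))
        rw [indicator_of_mem (show x - y ∈ (ball (0 : E) R)ᶜ from hz)]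
    calc rieszPot a f x ≤ ∫⁻ y, (ENNReal.ofReal τ * k (x - y) + F y * k (x - y))
        + f y * (ball (0 : E) R)ᶜ.indicator (rieszKernel a) (x - y) := lintegral_mono h1
      _ = ENNReal.ofReal τ * (ENNReal.ofReal (R ^ (d - a)) * A) + g x
          + ∫⁻ y, f y * (ball (0 : E) R)ᶜ.indicator (rieszKernel a) (x - y) := by
        have m1 : Measurable fun y => ENNReal.ofReal τ * k (x - y) := (hkx x).const_mul _
        have m2 : Measurable fun y => F y * k (x - y) := hFm.mul (hkx x)
        have m3 : Measurable fun y => ENNReal.ofReal τ * k (x - y) + F y * k (x - y) := m1.add m2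
        rw [lintegral_add_left m3, lintegral_add_left m1, lintegral_const_mul _ (hkx x),
          hk, lintegral_indicator_ball_sub hRp]
      _ ≤ ENNReal.ofReal t * A + g x + ENNReal.ofReal t * B := by
        refine add_le_add (add_le_add (le_of_eq ?_) le_rfl) (hfar f hf hf1 t ht x)
        rw [← mul_assoc, ← ENNReal.ofReal_mul (by positivity), hexp, hτ]
        congr 2
        rw [mul_left_comm, ← Real.rpow_add ht]; simp
      _ = _ := by ring
  have hgi : ∫⁻ x, g x = ENNReal.ofReal (R ^ (d - a)) * A * ∫⁻ y, F y := by
    rw [hg, lintegral_lintegral_swap]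
    · rw [← lintegral_const_mul _ hFm]
      refine lintegral_congr fun y => ?_
      have m1 : Measurable fun x => k (x - y) := hkm.comp (measurable_id.sub measurable_const)
      rw [lintegral_const_mul _ m1,
        show (∫⁻ x, k (x - y)) = ∫⁻ x, k x from lintegral_sub_right_eq_self _ y, hk,
        lintegral_indicator measurableSet_ball, setLIntegral_ball_rieszKernel hRp, mul_comm]
    · exact ((hFm.comp measurable_snd).mul
        (hkm.comp (measurable_fst.sub measurable_snd))).aemeasurable
  have hsub : {x | ENNReal.ofReal t < rieszPot a f x / (A + B + 1)} ⊆ {x | ENNReal.ofReal t ≤ g x} := by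
    intro x hx
    have h1 : ENNReal.ofReal t * (A + B + 1) < rieszPot a f x :=
      (ENNReal.lt_div_iff_mul_lt (Or.inl (by simp)) (Or.inl hK)).1 hx
    have h2 := h1.trans_le (hbound x)
    rw [mul_add, mul_one, mul_comm] at h2
    exact (lt_of_add_lt_add_left h2).le
  refine (measure_mono hsub).trans ?_
  have h3 := mul_meas_ge_le_lintegral (μ := volume) hgm (ENNReal.ofReal t)
  rw [hgi, hexp] at h3
  have ht0 : ENNReal.ofReal t ≠ 0 := by simpa using ht
  rw [ENNReal.ofReal_mul ht.le, mul_assoc, mul_assoc] at h3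
  have h4 := (ENNReal.mul_le_mul_iff_right ht0 ENNReal.ofReal_ne_top).1 h3
  refine h4.trans_eq ?_
  rw [← mul_assoc, mul_comm A]

/-- The level-set bound is inserted into the layer-cake formula and the integrals in t and y are
exchanged. For fixed y, t runs up to f(y)^{r/s}, and with e = s - s/r the result is f · f^{(r/s)e} /
e = f^r / e. -/
theorem exists_lintegral_rieszPot_rpow_le (hd : 1 ≤ finrank ℝ E) {a r s : ℝ}
    (had : a < finrank ℝ E)
    (hr : 1 < r) (hs : 0 < s) (h : 1 / s = 1 / r - (finrank ℝ E - a) / finrank ℝ E) :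
    ∃ C : ℝ≥0∞, C ≠ ⊤ ∧ ∀ f : E → ℝ≥0∞, Measurable f → ∫⁻ y, f y ^ r ≤ 1 →
      ∫⁻ x, rieszPot a f x ^ s ≤ C := by
  obtain ⟨A, K, hA, hK, hK0, hlev⟩ := measure_lt_rieszPot_le (E := E) hd had hr hs h
  have hps : ProperSpace E := FiniteDimensional.proper_real E
  set e := s - s / r with he_def
  have he : 0 < e := by
    have : s / r < s := div_lt_self hs hr
    linarith
  refine ⟨K ^ s * (ENNReal.ofReal s * (A / ENNReal.ofReal e)), ?_, fun f hf hf1 => ?_⟩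
  · have : ENNReal.ofReal e ≠ 0 := by simpa using he
    have : K ^ s ≠ ⊤ := ENNReal.rpow_ne_top_of_nonneg hs.le hK
    finiteness
  set G : E → ℝ≥0∞ := fun x => rieszPot a f x / K with hG
  have hGm : Measurable G := (measurable_rieszPot a hf).div_const K
  have h1 : ∀ x, rieszPot a f x ^ s = K ^ s * (ENNReal.ofReal s *
      ∫⁻ t in Ioi (0 : ℝ), {t : ℝ | ENNReal.ofReal t < G x}.indicator
        (fun t => ENNReal.ofReal (t ^ (s - 1))) t) := by
    intro x
    rw [setLIntegral_Ioi_indicator_rpow hs, ENNReal.mul_div_cancel (by simpa using hs)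
      ENNReal.ofReal_ne_top, ← ENNReal.mul_rpow_of_nonneg _ _ hs.le, hG,
      ENNReal.mul_div_cancel hK0 hK]
  have hm1 : Measurable (Function.uncurry fun (x : E) (t : ℝ) =>
      {t : ℝ | ENNReal.ofReal t < G x}.indicator (fun t => ENNReal.ofReal (t ^ (s - 1))) t) := by
    have : (Function.uncurry fun (x : E) (t : ℝ) =>
      {t : ℝ | ENNReal.ofReal t < G x}.indicator (fun t => ENNReal.ofReal (t ^ (s - 1))) t)
      = {p : E × ℝ | ENNReal.ofReal p.2 < G p.1}.indicator
        (fun p => ENNReal.ofReal (p.2 ^ (s - 1))) := by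
      ext p; simp [Function.uncurry, indicator]
    rw [this]
    refine Measurable.indicator (by fun_prop) (measurableSet_lt (by fun_prop) (by fun_prop))
  simp_rw [h1]
  rw [lintegral_const_mul, lintegral_const_mul]
  rotate_left
  · exact hm1.lintegral_prod_right'
  · exact (hm1.lintegral_prod_right').const_mul _
  gcongr
  rw [lintegral_lintegral_swap hm1.aemeasurable]
  have hm2 : Measurable (Function.uncurry fun (t : ℝ) (y : E) => ENNReal.ofReal (t ^ (e - 1)) *
      {y | ENNReal.ofReal (t ^ (s / r)) < f y}.indicator f y) := by
    have : (Function.uncurry fun (t : ℝ) (y : E) => ENNReal.ofReal (t ^ (e - 1)) *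
      {y | ENNReal.ofReal (t ^ (s / r)) < f y}.indicator f y)
      = fun p => ENNReal.ofReal (p.1 ^ (e - 1)) *
        {p : ℝ × E | ENNReal.ofReal (p.1 ^ (s / r)) < f p.2}.indicator (fun p => f p.2) p := by
      ext p; simp [Function.uncurry, indicator]
    rw [this]
    refine Measurable.mul (by fun_prop) (Measurable.indicator (by fun_prop)
      (measurableSet_lt (by fun_prop) (by fun_prop)))
  calc ∫⁻ t in Ioi (0 : ℝ), ∫⁻ x, {t : ℝ | ENNReal.ofReal t < G x}.indicator
          (fun t => ENNReal.ofReal (t ^ (s - 1))) t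
      ≤ ∫⁻ t in Ioi (0 : ℝ), A * ∫⁻ y, ENNReal.ofReal (t ^ (e - 1)) *
          {y | ENNReal.ofReal (t ^ (s / r)) < f y}.indicator f y := by
        refine setLIntegral_mono (hm2.lintegral_prod_right'.const_mul _) fun t ht => ?_
        have ht : 0 < t := ht
        have e1 : ∫⁻ x, {t : ℝ | ENNReal.ofReal t < G x}.indicator
          (fun t => ENNReal.ofReal (t ^ (s - 1))) t
          = ENNReal.ofReal (t ^ (s - 1)) * volume {x | ENNReal.ofReal t < G x} := by
          rw [← lintegral_indicator_const (measurableSet_lt measurable_const hGm)]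
          refine lintegral_congr fun x => ?_
          simp [indicator]
        rw [e1, lintegral_const_mul _ (hf.indicator (measurableSet_lt measurable_const hf))]
        refine (mul_le_mul_right (hlev f hf hf1 t ht) _).trans_eq ?_
        have e2 : t ^ (e - 1) = t ^ (s - 1) * t ^ (-(s / r)) := by
          rw [← Real.rpow_add ht]; congr 1; rw [he_def]; ring
        rw [e2, ENNReal.ofReal_mul (by positivity)]
        ring
    _ = A * ∫⁻ y, ∫⁻ t in Ioi (0 : ℝ), ENNReal.ofReal (t ^ (e - 1)) *
          {y | ENNReal.ofReal (t ^ (s / r)) < f y}.indicator f y := by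
        rw [lintegral_const_mul, lintegral_lintegral_swap hm2.aemeasurable]
        exact hm2.lintegral_prod_right'
    _ = A * ∫⁻ y, f y ^ r / ENNReal.ofReal e := by
        congr 1
        refine lintegral_congr fun y => ?_
        have e1 : ∀ t ∈ Ioi (0 : ℝ), ENNReal.ofReal (t ^ (e - 1)) *
          {y | ENNReal.ofReal (t ^ (s / r)) < f y}.indicator f y
          = f y * {t : ℝ | ENNReal.ofReal t < f y ^ (r / s)}.indicator
            (fun t => ENNReal.ofReal (t ^ (e - 1))) t := by
          intro t ht
          have hiff : ENNReal.ofReal (t ^ (s / r)) < f y ↔ ENNReal.ofReal t < f y ^ (r / s) := by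
            rw [← ENNReal.ofReal_rpow_of_nonneg (le_of_lt ht) (by positivity),
              ← inv_div s r, ENNReal.lt_rpow_inv_iff (by positivity)]
          by_cases hy : ENNReal.ofReal (t ^ (s / r)) < f y
          · rw [indicator_of_mem (show y ∈ {y | ENNReal.ofReal (t ^ (s / r)) < f y} from hy),
              indicator_of_mem (show t ∈ {t : ℝ | ENNReal.ofReal t < f y ^ (r / s)} from hiff.1 hy),
              mul_comm]
          · rw [indicator_of_notMem (show y ∉ {y | ENNReal.ofReal (t ^ (s / r)) < f y} from hy),
              indicator_of_notMem (show t ∉ {t : ℝ | ENNReal.ofReal t < f y ^ (r / s)} from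
                fun h => hy (hiff.2 h))]
            simp
        rw [setLIntegral_congr_fun measurableSet_Ioi e1, lintegral_const_mul,
          setLIntegral_Ioi_indicator_rpow he, ← ENNReal.rpow_mul, ← mul_div_assoc]
        · congr 1
          nth_rewrite 1 [← ENNReal.rpow_one (f y)]
          have e3 : r / s * e = r - 1 := by rw [he_def]; field_simp
          rw [e3, ← ENNReal.rpow_add_of_nonneg _ _ zero_le_one (by linarith)]
          congr 1; ring
        · exact Measurable.indicator (by fun_prop) (measurableSet_lt (by fun_prop) (by fun_prop))
    _ ≤ A / ENNReal.ofReal e := by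
        simp_rw [div_eq_mul_inv]
        rw [lintegral_mul_const _ (hf.pow_const r)]
        gcongr
        exact (mul_le_mul_left hf1 _).trans_eq (one_mul _)

/-- The Hardy–Littlewood–Sobolev inequality. -/
theorem exists_rieszPot_le (hd : 1 ≤ finrank ℝ E) {a r s : ℝ}
    (had : a < finrank ℝ E)
    (hr : 1 < r) (hs : 0 < s) (h : 1 / s = 1 / r - (finrank ℝ E - a) / finrank ℝ E) :
    ∃ C : ℝ≥0∞, C ≠ ⊤ ∧ ∀ f : E → ℝ≥0∞, Measurable f →
      (∫⁻ x, rieszPot a f x ^ s) ^ (1 / s) ≤ C * (∫⁻ y, f y ^ r) ^ (1 / r) := by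
  obtain ⟨C, hC, H⟩ := exists_lintegral_rieszPot_rpow_le (E := E) hd had hr hs h
  have hr0 : 0 < r := by linarith
  -- The added 1 makes the constant nonzero, so that the right-hand side is ∞ when the norm of f is.
  refine ⟨C ^ (1 / s) + 1, by
    have : C ^ (1 / s) ≠ ⊤ := ENNReal.rpow_ne_top_of_nonneg (by positivity) hC
    finiteness, fun f hf => ?_⟩
  set N := (∫⁻ y, f y ^ r) ^ (1 / r) with hN
  have hNr : N ^ r = ∫⁻ y, f y ^ r := by
    rw [hN, ← ENNReal.rpow_mul, one_div, inv_mul_cancel₀ hr0.ne', ENNReal.rpow_one]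
  by_cases h0 : N = 0
  · have h1 : ∫⁻ y, f y ^ r = 0 := by rw [← hNr, h0, ENNReal.zero_rpow_of_pos hr0]
    rw [lintegral_eq_zero_iff (hf.pow_const r)] at h1
    have h2 : ∀ x, rieszPot a f x = 0 := fun x => by
      rw [rieszPot, lintegral_eq_zero_iff]
      · filter_upwards [h1] with y hy
        have : f y = 0 := by simpa [hr0, hr0.not_gt] using hy
        simp [this]
      · exact hf.mul ((measurable_rieszKernel a).comp (measurable_const.sub measurable_id))
    simp [h2, hs]
  by_cases htop : N = ⊤
  · rw [htop, ENNReal.mul_top (by simp)]; exact le_top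
  -- Homogeneity: the normalised estimate applies to f / N once N is neither 0 nor ∞.
  have hg : ∫⁻ y, (N⁻¹ * f y) ^ r ≤ 1 := by
    simp_rw [ENNReal.mul_rpow_of_nonneg _ _ hr0.le]
    rw [lintegral_const_mul _ (hf.pow_const r), ← hNr, ← ENNReal.mul_rpow_of_nonneg _ _ hr0.le,
      ENNReal.inv_mul_cancel h0 htop, ENNReal.one_rpow]
  have h3 := H _ (hf.const_mul N⁻¹) hg
  have h4 : ∀ x, rieszPot a f x = N * rieszPot a (fun y => N⁻¹ * f y) x := fun x => by
    rw [rieszPot, rieszPot, ← lintegral_const_mul]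
    · refine lintegral_congr fun y => ?_
      rw [← mul_assoc, ← mul_assoc, ENNReal.mul_inv_cancel h0 htop, one_mul]
    · exact (hf.const_mul _).mul
        ((measurable_rieszKernel a).comp (measurable_const.sub measurable_id))
  simp_rw [h4, ENNReal.mul_rpow_of_nonneg _ _ hs.le]
  rw [lintegral_const_mul _ ((measurable_rieszPot a (hf.const_mul _)).pow_const s),
    ENNReal.mul_rpow_of_nonneg _ _ (by positivity), ← ENNReal.rpow_mul, mul_one_div_cancel hs.ne',
    ENNReal.rpow_one, mul_comm]
  gcongr
  exact (ENNReal.rpow_le_rpow h3 (by positivity)).trans (le_add_of_nonneg_right zero_le_one)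

end HardyLittlewoodSobolev

/-! ### `L^r` norms of extended nonnegative functions and regularity lifting. -/

section LrNorm

open Set
open scoped ENNReal

variable {α : Type*} [MeasureSpace α]

/-- The `L^r` (quasi)norm of an extended nonnegative function. -/
noncomputable def lrNorm (r : ℝ) (f : α → ℝ≥0∞) : ℝ≥0∞ := (∫⁻ x, f x ^ r) ^ (1 / r)

theorem lrNorm_ne_top_iff {r : ℝ} (hr : 0 < r) {f : α → ℝ≥0∞} :
    lrNorm r f ≠ ⊤ ↔ ∫⁻ x, f x ^ r ≠ ⊤ := by
  rw [lrNorm, Ne, ENNReal.rpow_eq_top_iff_of_pos (by positivity)]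

theorem lrNorm_mono {r : ℝ} (hr : 0 < r) {f g : α → ℝ≥0∞} (h : f ≤ᵐ[volume] g) :
    lrNorm r f ≤ lrNorm r g := by
  refine ENNReal.rpow_le_rpow (lintegral_mono_ae ?_) (by positivity)
  filter_upwards [h] with x hx
  exact ENNReal.rpow_le_rpow hx hr.le

theorem lrNorm_add_le {r : ℝ} (hr : 1 ≤ r) {f g : α → ℝ≥0∞} (hf : Measurable f)
    (hg : Measurable g) : lrNorm r (fun x => f x + g x) ≤ lrNorm r f + lrNorm r g :=
  ENNReal.lintegral_Lp_add_le hf.aemeasurable hg.aemeasurable hr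

theorem lrNorm_const_mul {r : ℝ} (hr : 0 < r) (c : ℝ≥0∞) {f : α → ℝ≥0∞} (hf : Measurable f) :
    lrNorm r (fun x => c * f x) = c * lrNorm r f := by
  simp_rw [lrNorm, ENNReal.mul_rpow_of_nonneg _ _ hr.le]
  rw [lintegral_const_mul _ (hf.pow_const r), ENNReal.mul_rpow_of_nonneg _ _ (by positivity),
    ← ENNReal.rpow_mul, mul_one_div_cancel hr.ne', ENNReal.rpow_one]

/-- Hölder's inequality. -/
theorem lrNorm_mul_le {p q r : ℝ} (hp : 0 < p) (hq : 0 < q) (hr : 0 < r) (h : 1 / p = 1 / q + 1 / r)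
    {f g : α → ℝ≥0∞} (hf : Measurable f) (hg : Measurable g) :
    lrNorm p (fun x => f x * g x) ≤ lrNorm q f * lrNorm r g := by
  refine ENNReal.lintegral_Lp_mul_le_Lq_mul_Lr hp ?_ h volume hf.aemeasurable hg.aemeasurable
  have : 0 < 1 / r := by positivity
  exact (one_div_lt_one_div hq hp).1 (by linarith)

/-- Pointwise on Ω, f^s ≤ 1 + f^r, and the constant is integrable on a set of finite measure. No
measurability of f is needed. -/
theorem lintegral_rpow_ne_top_of_le {Ω : Set α} (hΩ : MeasurableSet Ω) (hv : volume Ω ≠ ⊤)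
    {f : α → ℝ≥0∞} (h0 : ∀ x ∉ Ω, f x = 0) {r s : ℝ} (hs : 0 < s) (hsr : s ≤ r)
    (h : ∫⁻ x, f x ^ r ≠ ⊤) : ∫⁻ x, f x ^ s ≠ ⊤ := by
  have h1 : ∫⁻ x, f x ^ s ≤ ∫⁻ x, (Ω.indicator 1 x + f x ^ r) := by
    refine lintegral_mono fun x => ?_
    by_cases hx : x ∈ Ω
    · rw [indicator_of_mem hx, Pi.one_apply]
      rcases le_total (f x) 1 with h1 | h1
      · exact (ENNReal.rpow_le_one h1 hs.le).trans (le_add_of_nonneg_right zero_le)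
      · exact (ENNReal.rpow_le_rpow_of_exponent_le h1 hsr).trans (le_add_of_nonneg_left zero_le)
    · simp [h0 x hx, hs]
  rw [lintegral_add_left (measurable_one.indicator hΩ), lintegral_indicator_one hΩ] at h1
  exact ne_top_of_le_ne_top (ENNReal.add_ne_top.2 ⟨hv, h⟩) h1

theorem lrNorm_ne_top_of_le {Ω : Set α} (hΩ : MeasurableSet Ω) (hv : volume Ω ≠ ⊤)
    {f : α → ℝ≥0∞} (h0 : ∀ x ∉ Ω, f x = 0) {r s : ℝ} (hs : 0 < s) (hsr : s ≤ r)
    (h : lrNorm r f ≠ ⊤) : lrNorm s f ≠ ⊤ :=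
  (lrNorm_ne_top_iff hs).2 (lintegral_rpow_ne_top_of_le hΩ hv h0 hs hsr
    ((lrNorm_ne_top_iff (hs.trans_le hsr)).1 h))

theorem lrNorm_rpow_ne_top {f : α → ℝ≥0∞} {r p : ℝ} (hr : 0 < r) (hp : 0 < p)
    (h : lrNorm r f ≠ ⊤) : lrNorm (r / p) (fun x => f x ^ p) ≠ ⊤ := by
  rw [lrNorm_ne_top_iff (by positivity)]
  simp_rw [← ENNReal.rpow_mul, mul_div_cancel₀ r hp.ne']
  exact (lrNorm_ne_top_iff hr).1 h

theorem lrNorm_indicator_const_ne_top {Ω : Set α} (hΩ : MeasurableSet Ω) (hv : volume Ω ≠ ⊤)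
    {c : ℝ≥0∞} (hc : c ≠ ⊤) {r : ℝ} (hr : 0 < r) : lrNorm r (Ω.indicator fun _ => c) ≠ ⊤ := by
  rw [lrNorm_ne_top_iff hr]
  have h1 : ∀ x, (Ω.indicator fun _ => c) x ^ r = (Ω.indicator fun _ => c ^ r) x := fun x => by
    by_cases hx : x ∈ Ω <;> simp [hx, hr]
  simp_rw [h1]
  rw [lintegral_indicator_const hΩ]
  exact ENNReal.mul_ne_top (ENNReal.rpow_ne_top_of_nonneg hr.le hc) hv

/-- Dominated convergence: U is finite almost everywhere, so each point eventually leaves the set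
where U > M. This supplies the small coefficient that makes the linearised operator a contraction.
-/
theorem tendsto_lrNorm_indicator_lt {r : ℝ} (hr : 0 < r) {p : ℝ} (hp : 0 < p) {U : α → ℝ≥0∞}
    (hU : Measurable U) (h : lrNorm r (fun x => U x ^ p) ≠ ⊤) :
    Tendsto (fun M : ℕ => lrNorm r ({x | (M : ℝ≥0∞) < U x}.indicator fun x => U x ^ p)) atTop (𝓝 0) := by
  have hint := (lrNorm_ne_top_iff hr).1 h
  have h1 : Tendsto (fun M : ℕ => ∫⁻ x, ({x | (M : ℝ≥0∞) < U x}.indicator (fun x => U x ^ p) x) ^ r)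
      atTop (𝓝 (∫⁻ _ : α, 0)) := by
    refine tendsto_lintegral_of_dominated_convergence (fun x => (U x ^ p) ^ r) (fun M => ?_)
      (fun M => Eventually.of_forall fun x => ?_) hint ?_
    · exact (Measurable.indicator (by fun_prop) (measurableSet_lt measurable_const hU)).pow_const r
    · exact ENNReal.rpow_le_rpow (indicator_le_self' (fun _ _ => zero_le) x) hr.le
    · have hfin := ae_lt_top (((hU.pow_const p).pow_const r)) hint
      filter_upwards [hfin] with x hx
      have hx' : U x ≠ ⊤ := by
        intro htop
        rw [htop, ENNReal.top_rpow_of_pos hp, ENNReal.top_rpow_of_pos hr] at hx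
        exact lt_irrefl _ hx
      obtain ⟨N, hN⟩ := ENNReal.exists_nat_gt hx'
      refine tendsto_const_nhds.congr' ?_
      filter_upwards [eventually_ge_atTop N] with M hM
      rw [indicator_of_notMem, ENNReal.zero_rpow_of_pos hr]
      intro hlt
      have : (N : ℝ≥0∞) ≤ M := by exact_mod_cast hM
      exact absurd (hN.trans_le this) (not_lt.2 (le_of_lt hlt))
  rw [lintegral_zero] at h1
  have h2 := h1.ennrpow_const (1 / r)
  rwa [ENNReal.zero_rpow_of_pos (by positivity)] at h2

/-- Regularity lifting by a positive linear operator which is a contraction in two `L^r` norms. -/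
theorem lrNorm_ne_top_of_le_add {T : (α → ℝ≥0∞) → α → ℝ≥0∞} {r₀ r₁ : ℝ} (hr₀ : 0 < r₀)
    (hr₁ : 1 ≤ r₁) (hTm : ∀ v, Measurable v → Measurable (T v))
    (hTmono : ∀ v w, v ≤ᵐ[volume] w → ∀ x, T v x ≤ T w x)
    (hTadd : ∀ v w, Measurable v → Measurable w → ∀ x, T (fun y => v y + w y) x = T v x + T w x)
    (hT₀ : ∀ v, Measurable v → lrNorm r₀ (T v) ≤ 2⁻¹ * lrNorm r₀ v)
    (hT₁ : ∀ v, Measurable v → lrNorm r₁ (T v) ≤ 2⁻¹ * lrNorm r₁ v)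
    {U g : α → ℝ≥0∞} (hU : Measurable U) (hg : Measurable g) (hU₀ : lrNorm r₀ U ≠ ⊤)
    (hg₁ : lrNorm r₁ g ≠ ⊤) (hle : ∀ᵐ x, U x ≤ g x + T U x) : lrNorm r₁ U ≠ ⊤ := by
  have hr₁0 : 0 < r₁ := by linarith
  -- S J is the partial Neumann sum g + Tg + … + T^{J-1} g. Since U is not yet known to lie in
  -- L^{r₁}, its norm cannot be absorbed there directly; U is compared with the limit of these sums
  -- instead.
  let S : ℕ → α → ℝ≥0∞ := fun J => (fun v x => g x + T v x)^[J] 0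
  have hS0 : S 0 = 0 := rfl
  have hSs : ∀ J, S (J + 1) = fun x => g x + T (S J) x := fun J =>
    Function.iterate_succ_apply' _ J _
  have hTs : ∀ J, T^[J + 1] U = T (T^[J] U) := fun J => Function.iterate_succ_apply' _ J _
  have hSm : ∀ J, Measurable (S J) := by
    intro J
    induction J with
    | zero => rw [hS0]; exact measurable_zero
    | succ J ih => rw [hSs]; exact hg.add (hTm _ ih)
  have hTJm : ∀ J, Measurable (T^[J] U) := by
    intro J
    induction J with
    | zero => exact hU
    | succ J ih => rw [hTs]; exact hTm _ ih
  have hSmono : Monotone S := by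
    refine monotone_nat_of_le_succ fun J => ?_
    induction J with
    | zero => rw [hS0]; exact fun x => zero_le
    | succ J ih =>
      rw [hSs, hSs (J + 1)]
      intro x
      exact add_le_add le_rfl (hTmono _ _ (Eventually.of_forall ih) x)
  have hUS : ∀ J, ∀ᵐ x, U x ≤ S J x + T^[J] U x := by
    intro J
    induction J with
    | zero => simp [hS0]
    | succ J ih =>
      filter_upwards [hle] with x hx
      rw [hSs, hTs]
      refine hx.trans ?_
      rw [add_assoc, ← hTadd _ _ (hSm J) (hTJm J)]
      exact add_le_add le_rfl (hTmono _ _ ih x)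
  have hSn : ∀ J, lrNorm r₁ (S J) ≤ 2 * lrNorm r₁ g := by
    intro J
    induction J with
    | zero =>
      have : lrNorm r₁ (0 : α → ℝ≥0∞) = 0 := by simp [lrNorm, hr₁0]
      rw [hS0, this]; exact zero_le
    | succ J ih =>
      rw [hSs]
      calc _ ≤ lrNorm r₁ g + lrNorm r₁ (T (S J)) := lrNorm_add_le hr₁ hg (hTm _ (hSm J))
        _ ≤ lrNorm r₁ g + 2⁻¹ * (2 * lrNorm r₁ g) := by
          gcongr; exact (hT₁ _ (hSm J)).trans (by gcongr)
        _ = 2 * lrNorm r₁ g := by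
          rw [← mul_assoc, ENNReal.inv_mul_cancel (by simp) (by simp)]; ring
  have hTn : ∀ J, lrNorm r₀ (T^[J] U) ≤ 2⁻¹ ^ J * lrNorm r₀ U := by
    intro J
    induction J with
    | zero => simp
    | succ J ih =>
      rw [hTs]
      refine (hT₀ _ (hTJm J)).trans ?_
      rw [pow_succ', mul_assoc]; gcongr
  -- The remainder T^J U tends to 0 in the L^{r₀} norm. Because S J increases, the infimum over J
  -- suffices and no almost everywhere convergent subsequence has to be extracted.
  have hD : ∀ᵐ x, ⨅ J, T^[J] U x = 0 := by
    have h1 : lrNorm r₀ (fun x => ⨅ J, T^[J] U x) = 0 := by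
      refine le_antisymm ?_ zero_le
      have h2 : Tendsto (fun J : ℕ => (2⁻¹ : ℝ≥0∞) ^ J * lrNorm r₀ U) atTop (𝓝 (0 * lrNorm r₀ U)) :=
        ENNReal.Tendsto.mul_const (ENNReal.tendsto_pow_atTop_nhds_zero_of_lt_one (by simp))
          (Or.inr hU₀)
      rw [zero_mul] at h2
      refine ge_of_tendsto' h2 fun J => (lrNorm_mono hr₀ ?_).trans (hTn J)
      exact Eventually.of_forall fun x => iInf_le _ J
    have hm : Measurable fun x => ⨅ J, T^[J] U x := Measurable.iInf hTJm
    rw [lrNorm, ENNReal.rpow_eq_zero_iff_of_pos (by positivity),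
      lintegral_eq_zero_iff (hm.pow_const _)] at h1
    filter_upwards [h1] with x hx
    rwa [Pi.zero_apply, ENNReal.rpow_eq_zero_iff_of_pos hr₀] at hx
  have hUle : U ≤ᵐ[volume] fun x => ⨆ J, S J x := by
    filter_upwards [hD, ae_all_iff.2 hUS] with x hx hx2
    calc U x ≤ ⨅ J, ((⨆ J, S J x) + T^[J] U x) := le_iInf fun J => (hx2 J).trans
          (add_le_add (le_iSup (fun J => S J x) J) le_rfl)
      _ = ⨆ J, S J x := by rw [← ENNReal.add_iInf, hx, add_zero]
  refine ne_top_of_le_ne_top ?_ (lrNorm_mono hr₁0 hUle)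
  rw [lrNorm_ne_top_iff hr₁0]
  have h3 : ∀ x, (⨆ J, S J x) ^ r₁ = ⨆ J, (S J x) ^ r₁ := fun x =>
    (ENNReal.orderIsoRpow r₁ hr₁0).map_iSup _
  simp_rw [h3]
  rw [lintegral_iSup (fun J => (hSm J).pow_const r₁)
    (fun i j hij x => ENNReal.rpow_le_rpow (hSmono hij x) hr₁0.le)]
  refine ne_top_of_le_ne_top (b := (2 * lrNorm r₁ g) ^ r₁)
    (ENNReal.rpow_ne_top_of_nonneg hr₁0.le (by finiteness)) (iSup_le fun J => ?_)
  have h4 := ENNReal.rpow_le_rpow (hSn J) hr₁0.le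
  rwa [lrNorm, ← ENNReal.rpow_mul, one_div, inv_mul_cancel₀ hr₁0.ne', ENNReal.rpow_one] at h4

end LrNorm

/-! ### Regularity for the integral inequality: contraction, then bootstrap. -/

section IntegralRegularity

open Set Metric Module
open scoped ENNReal

variable {E : Type*} [NormedAddCommGroup E] [NormedSpace ℝ E] [FiniteDimensional ℝ E]
  [MeasureSpace E] [BorelSpace E] [(volume : Measure E).IsAddHaarMeasure]

theorem measurable_rieszKernel_sub (a : ℝ) (x : E) : Measurable fun y => rieszKernel a (x - y) :=
  (measurable_rieszKernel a).comp (measurable_const.sub measurable_id)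

theorem rieszPot_add (a : ℝ) {f : E → ℝ≥0∞} (hf : Measurable f) (g : E → ℝ≥0∞) (x : E) :
    rieszPot a (fun y => f y + g y) x = rieszPot a f x + rieszPot a g x := by
  simp_rw [rieszPot, add_mul]
  exact lintegral_add_left (hf.mul (measurable_rieszKernel_sub a x)) _

theorem rieszPot_const_mul (a : ℝ) (c : ℝ≥0∞) {f : E → ℝ≥0∞} (hf : Measurable f) (x : E) :
    rieszPot a (fun y => c * f y) x = c * rieszPot a f x := by
  simp_rw [rieszPot, mul_assoc]
  exact lintegral_const_mul _ (hf.mul (measurable_rieszKernel_sub a x))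

theorem exists_lrNorm_rieszPot_le (hd : 1 ≤ finrank ℝ E) {a r s : ℝ} (had : a < finrank ℝ E)
    (hr : 1 < r) (hs : 0 < s) (h : 1 / s = 1 / r - (finrank ℝ E - a) / finrank ℝ E) :
    ∃ C : ℝ≥0∞, C ≠ ⊤ ∧ ∀ f : E → ℝ≥0∞, Measurable f →
      lrNorm s (rieszPot a f) ≤ C * lrNorm r f :=
  exists_rieszPot_le hd had hr hs h

theorem lrNorm_rieszPot_ne_top (hd : 1 ≤ finrank ℝ E) {a r s : ℝ} (had : a < finrank ℝ E)
    (hr : 1 < r) (hs : 0 < s) (h : 1 / s = 1 / r - (finrank ℝ E - a) / finrank ℝ E)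
    {f : E → ℝ≥0∞} (hf : Measurable f) (hfr : lrNorm r f ≠ ⊤) :
    lrNorm s (rieszPot a f) ≠ ⊤ := by
  obtain ⟨C, hC, H⟩ := exists_lrNorm_rieszPot_le (E := E) hd had hr hs h
  exact ne_top_of_le_ne_top (ENNReal.mul_ne_top hC hfr) (H f hf)

/-- On a set of finite measure the Riesz potential is bounded from `L^t` to `L^∞` for large `t`. -/
theorem exists_rieszPot_le_const (hd : 1 ≤ finrank ℝ E) {a t : ℝ} (ha : 0 ≤ a)
    (ht : 1 < t) (hta : 1 / t < (finrank ℝ E - a) / finrank ℝ E)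
    {Ω : Set E} (hΩ : MeasurableSet Ω) (hv : volume Ω ≠ ⊤) {f : E → ℝ≥0∞} (hf : Measurable f)
    (h0 : ∀ x ∉ Ω, f x = 0) (hft : lrNorm t f ≠ ⊤) :
    ∃ C : ℝ≥0∞, C ≠ ⊤ ∧ ∀ x, rieszPot a f x ≤ C := by
  have hdp : (0 : ℝ) < finrank ℝ E := by exact_mod_cast hd
  have hconj := Real.HolderConjugate.conjExponent ht
  set t' := Real.conjExponent t with ht'
  have ht'0 : 0 < t' := hconj.symm.pos
  have hat : a * t' < finrank ℝ E := by
    have h1 : 1 / t' = 1 - 1 / t := by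
      have := hconj.inv_add_inv_eq_one
      simp only [one_div]; linarith
    have h2 : a / finrank ℝ E < 1 / t' := by
      rw [h1]
      have : a / finrank ℝ E = 1 - (finrank ℝ E - a) / finrank ℝ E := by field_simp; ring
      linarith
    rwa [div_lt_div_iff₀ hdp ht'0, one_mul] at h2
  have hA := setLIntegral_ball_rieszKernel_ne_top (E := E) hd 1 hat
  set A := ∫⁻ z in ball (0 : E) 1, rieszKernel (a * t') z with hA_def
  refine ⟨lrNorm t f * (A + volume Ω) ^ (1 / t'), ENNReal.mul_ne_top hft
    (ENNReal.rpow_ne_top_of_nonneg (by positivity) (by finiteness)), fun x => ?_⟩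
  have hk := measurable_rieszKernel_sub a x
  have h1 : rieszPot a f x = ∫⁻ y, f y * Ω.indicator (fun y => rieszKernel a (x - y)) y := by
    refine lintegral_congr fun y => ?_
    by_cases hy : y ∈ Ω
    · rw [indicator_of_mem hy]
    · rw [h0 y hy, zero_mul, zero_mul]
  rw [h1]
  refine (ENNReal.lintegral_mul_le_Lp_mul_Lq volume hconj hf.aemeasurable
    (hk.indicator hΩ).aemeasurable).trans ?_
  refine mul_le_mul_right (ENNReal.rpow_le_rpow ?_ (by positivity)) _
  -- Within distance 1 of x the kernel has an integrable t'-th power; farther away it is at most 1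
  -- and costs only the measure of Ω. The resulting bound is uniform in x.
  have h2 : ∀ y, Ω.indicator (fun y => rieszKernel a (x - y)) y ^ t'
      ≤ (ball (0 : E) 1).indicator (rieszKernel (a * t')) (x - y) + Ω.indicator 1 y := by
    intro y
    by_cases hy : y ∈ Ω
    · rw [indicator_of_mem hy, indicator_of_mem hy, rieszKernel_rpow a ht'0.le]
      by_cases hz : x - y ∈ ball (0 : E) 1
      · rw [indicator_of_mem hz]
        exact le_add_of_nonneg_right zero_le
      · refine le_trans ?_ (le_add_of_nonneg_left zero_le)
        have hz1 : 1 ≤ ‖x - y‖ := by simpa using hz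
        rw [rieszKernel, Pi.one_apply, ← ENNReal.ofReal_one]
        exact ENNReal.ofReal_le_ofReal (Real.rpow_le_one_of_one_le_of_nonpos hz1
          (by have := mul_nonneg ha ht'0.le; linarith))
    · rw [indicator_of_notMem hy, ENNReal.zero_rpow_of_pos ht'0]; exact zero_le
  calc _ ≤ ∫⁻ y, ((ball (0 : E) 1).indicator (rieszKernel (a * t')) (x - y) + Ω.indicator 1 y) :=
        lintegral_mono h2
    _ = A + volume Ω := by
      rw [lintegral_add_right _ (measurable_one.indicator hΩ), lintegral_indicator_one hΩ,
        lintegral_indicator_ball_sub one_pos, Real.one_rpow, ENNReal.ofReal_one, one_mul]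

/-- The linearised Choquard operator maps `L^r` to itself. -/
theorem exists_lrNorm_choquard_le (hd : 3 ≤ finrank ℝ E) {mu q r : ℝ}
    (hmu : mu < finrank ℝ E)
    (hq : 0 < q) (hq2 : 2 / q = (finrank ℝ E - mu) / finrank ℝ E + 2 / finrank ℝ E)
    (hr : 0 < r) (h1 : 1 / r + 1 / q < 1)
    (h2 : (finrank ℝ E - mu) / finrank ℝ E < 1 / r + 1 / q)
    (h3 : 1 / r + 2 / finrank ℝ E < 1) :
    ∃ C : ℝ≥0∞, C ≠ ⊤ ∧ ∀ H K v : E → ℝ≥0∞, Measurable H → Measurable K → Measurable v →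
      lrNorm r (rieszPot (finrank ℝ E - 2) fun y => rieszPot mu (fun x => H x * v x) y * K y)
        ≤ C * (lrNorm q H * lrNorm q K) * lrNorm r v := by
  set d : ℝ := (finrank ℝ E : ℝ) with hd_def
  have hd3 : (3 : ℝ) ≤ d := by rw [hd_def]; exact_mod_cast hd
  have hdp : 0 < d := by linarith
  have hq0 : 0 < 1 / q := by positivity
  have hr0 : 0 < 1 / r := by positivity
  have hq2' : 2 * (1 / q) = (d - mu) / d + 2 / d := by rw [← hq2]; ring
  -- Path of exponents: Hölder puts H v in L^{t₁}, the first potential maps to L^{t₂}, multiplying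
  -- by K gives L^{t₃}, and the potential of order two returns to L^r. The loop closes because 2/q =
  -- (d-μ)/d + 2/d.
  set t₁ := 1 / (1 / r + 1 / q) with ht₁
  set t₂ := 1 / (1 / r + 1 / q - (d - mu) / d) with ht₂
  set t₃ := 1 / (1 / r + 2 / d) with ht₃
  have ht₁p : 0 < t₁ := by positivity
  have ht₂p : 0 < t₂ := one_div_pos.2 (by linarith)
  have ht₃p : 0 < t₃ := by positivity
  have e1 : 1 / t₁ = 1 / r + 1 / q := one_div_one_div _
  have e2 : 1 / t₂ = 1 / r + 1 / q - (d - mu) / d := one_div_one_div _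
  have e3 : 1 / t₃ = 1 / r + 2 / d := one_div_one_div _
  have ht₁1 : 1 < t₁ := one_lt_one_div (by positivity) h1
  have ht₃1 : 1 < t₃ := one_lt_one_div (by positivity) h3
  obtain ⟨C₁, hC₁, H₁⟩ := exists_lrNorm_rieszPot_le (E := E) (by omega) hmu ht₁1 ht₂p
    (by rw [e1, e2])
  obtain ⟨C₂, hC₂, H₂⟩ := exists_lrNorm_rieszPot_le (E := E) (a := d - 2) (by omega) (by linarith)
    ht₃1 hr (by rw [e3]; ring)
  refine ⟨C₂ * C₁, ENNReal.mul_ne_top hC₂ hC₁, fun H K v hH hK hv => ?_⟩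
  have hHv : Measurable fun x => H x * v x := hH.mul hv
  have hV := measurable_rieszPot mu hHv
  calc _ ≤ C₂ * lrNorm t₃ (fun y => rieszPot mu (fun x => H x * v x) y * K y) :=
        H₂ _ (hV.mul hK)
    _ ≤ C₂ * (lrNorm t₂ (rieszPot mu fun x => H x * v x) * lrNorm q K) := by
        gcongr
        exact lrNorm_mul_le ht₃p ht₂p hq (by rw [e3, e2]; linarith) hV hK
    _ ≤ C₂ * ((C₁ * (lrNorm q H * lrNorm r v)) * lrNorm q K) := by
        gcongr
        refine (H₁ _ hHv).trans ?_
        gcongr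
        exact lrNorm_mul_le ht₁p hq hr (by rw [e1]; ring) hH hv
    _ = _ := by ring

/-- First step of the regularity proof: integrability beyond the Sobolev exponent. -/
theorem lrNorm_ne_top_of_le_choquard (hd : 3 ≤ finrank ℝ E) {mu p r : ℝ} (hmu0 : 0 < mu)
    (hmu : mu < finrank ℝ E) (hp : p * (finrank ℝ E - 2) = 2 * finrank ℝ E - mu)
    {Ω : Set E} (hΩ : MeasurableSet Ω) (hv : volume Ω ≠ ⊤) {U : E → ℝ≥0∞} (hU : Measurable U)
    (h0 : ∀ x ∉ Ω, U x = 0)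
    (hUs : lrNorm (2 * finrank ℝ E / (finrank ℝ E - 2)) U ≠ ⊤)
    {C₀ C : ℝ≥0∞} (hC₀ : C₀ ≠ ⊤) (hC : C ≠ ⊤)
    (hle : ∀ᵐ x, U x ≤ Ω.indicator (fun _ => C₀) x
      + C * rieszPot (finrank ℝ E - 2) (fun y => rieszPot mu (fun x => U x ^ p) y * U y ^ (p - 1)) x)
    (hr : 0 < r) (hr1 : (finrank ℝ E - mu - 2) / (2 * finrank ℝ E) < 1 / r)
    (hr2 : 1 / r < (finrank ℝ E - 2) / (2 * finrank ℝ E)) : lrNorm r U ≠ ⊤ := by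
  set d : ℝ := (finrank ℝ E : ℝ) with hd_def
  have hd3 : (3 : ℝ) ≤ d := by rw [hd_def]; exact_mod_cast hd
  have hdp : 0 < d := by linarith
  have hd2 : 0 < d - 2 := by linarith
  have hp1 : 0 < p - 1 := by
    have : (p - 1) * (d - 2) = d - mu + 2 := by linarith
    by_contra hcon
    nlinarith
  -- This q equals s/(p-1) with s = 2d/(d-2), so U^{p-1} ∈ L^q is exactly the Sobolev information;
  -- it is also the scale-invariant exponent for which the operator preserves L^ρ.
  set q := 2 * d / (d - mu + 2) with hq
  have hq0 : 0 < q := div_pos (by linarith) (by linarith)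
  have eq1 : 1 / q = (d - mu + 2) / (2 * d) := one_div_div _ _
  have hqs : q = 2 * d / (d - 2) / (p - 1) := by
    rw [hq, div_div]; congr 1; linarith
  set s := 2 * d / (d - 2) with hs
  have hs0 : 0 < s := by positivity
  have es : 1 / s = (d - 2) / (2 * d) := one_div_div _ _
  have hKq : lrNorm q (fun x => U x ^ (p - 1)) ≠ ⊤ := by
    rw [hqs]; exact lrNorm_rpow_ne_top hs0 hp1 hUs
  have hd2d : 2 / d = 4 / (2 * d) := by field_simp; norm_num
  have hmd : (d - mu) / d = (2 * d - 2 * mu) / (2 * d) := by field_simp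
  have hq2 : 2 / q = (d - mu) / d + 2 / d := by
    have : 2 / q = 2 * (1 / q) := by ring
    rw [this, eq1]; field_simp
  have key : ∀ ρ : ℝ, 0 < ρ → (d - mu - 2) / (2 * d) < 1 / ρ → 1 / ρ ≤ (d - 2) / (2 * d) →
      ∃ C : ℝ≥0∞, C ≠ ⊤ ∧ ∀ H K v : E → ℝ≥0∞, Measurable H → Measurable K → Measurable v →
      lrNorm ρ (rieszPot (d - 2) fun y => rieszPot mu (fun x => H x * v x) y * K y)
        ≤ C * (lrNorm q H * lrNorm q K) * lrNorm ρ v := by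
    intro ρ hρ a1 a2
    refine exists_lrNorm_choquard_le hd hmu hq0 hq2 hρ ?_ ?_ ?_
    · have : (d - 2) / (2 * d) + (d - mu + 2) / (2 * d) < 1 := by
        rw [← add_div, div_lt_one (by positivity)]; linarith
      rw [eq1]; linarith
    · have : (d - mu) / d = (d - mu - 2) / (2 * d) + (d - mu + 2) / (2 * d) := by
        rw [hmd, ← add_div]; ring
      rw [eq1]; linarith
    · have : (d - 2) / (2 * d) + 2 / d < 1 := by
        rw [hd2d, ← add_div, div_lt_one (by positivity)]; linarith
      linarith
  obtain ⟨A, hA, HA⟩ := key r hr hr1 hr2.le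
  obtain ⟨B, hB, HB⟩ := key s hs0 (by rw [es]; gcongr ?_ / _; linarith) es.le
  set K : E → ℝ≥0∞ := fun x => U x ^ (p - 1) with hK
  have hKm : Measurable K := hU.pow_const _
  set D : ℝ≥0∞ := C * ((A + B) * lrNorm q K) with hD
  have hDt : D ≠ ⊤ := by finiteness
  have htend := ENNReal.Tendsto.const_mul (tendsto_lrNorm_indicator_lt hq0 hp1 hU hKq)
    (Or.inr hDt)
  rw [mul_zero] at htend
  -- One level M serves both exponents, since D contains the sum A + B of the two operator
  -- constants.
  obtain ⟨M, hM⟩ := (htend.eventually (gt_mem_nhds (show (0 : ℝ≥0∞) < 2⁻¹ by simp))).exists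
  have hMset : MeasurableSet {x | (M : ℝ≥0∞) < U x} := measurableSet_lt measurable_const hU
  set H : E → ℝ≥0∞ := {x | (M : ℝ≥0∞) < U x}.indicator K with hH
  have hHm : Measurable H := hKm.indicator hMset
  -- Only the factor inside the inner potential is truncated; K remains whole, since smallness of H
  -- alone gives the factor 1/2.
  set T : (E → ℝ≥0∞) → E → ℝ≥0∞ := fun v x =>
    C * rieszPot (d - 2) (fun y => rieszPot mu (fun x => H x * v x) y * K y) x with hT
  have hin : ∀ v, Measurable v → Measurable fun y => rieszPot mu (fun x => H x * v x) y * K y :=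
    fun v hv => (measurable_rieszPot mu (hHm.mul hv)).mul hKm
  have hTnorm : ∀ ρ : ℝ, 0 < ρ → ∀ A' : ℝ≥0∞, A' ≤ A + B → (∀ v : E → ℝ≥0∞, Measurable v →
      lrNorm ρ (rieszPot (d - 2) fun y => rieszPot mu (fun x => H x * v x) y * K y)
        ≤ A' * (lrNorm q H * lrNorm q K) * lrNorm ρ v) → ∀ v, Measurable v →
        lrNorm ρ (T v) ≤ 2⁻¹ * lrNorm ρ v := by
    intro ρ hρ A' hA' hyp v hv
    rw [hT, lrNorm_const_mul hρ _ (measurable_rieszPot _ (hin v hv))]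
    calc _ ≤ C * ((A + B) * (lrNorm q H * lrNorm q K) * lrNorm ρ v) := by
          gcongr; exact (hyp v hv).trans (by gcongr)
      _ = D * lrNorm q H * lrNorm ρ v := by rw [hD]; ring
      _ ≤ _ := by gcongr
  set H' : E → ℝ≥0∞ := fun x => Ω.indicator (fun _ => (M : ℝ≥0∞) ^ p) x with hH'
  have hH'm : Measurable H' := measurable_const.indicator hΩ
  have hsplit : ∀ x, U x ^ p ≤ H' x + H x * U x := by
    intro x
    by_cases hx : x ∈ Ω
    · by_cases hM' : (M : ℝ≥0∞) < U x
      · refine le_trans (le_of_eq ?_) (le_add_of_nonneg_left zero_le)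
        rw [hH, indicator_of_mem (show x ∈ {x | (M : ℝ≥0∞) < U x} from hM')]
        have h1 := ENNReal.rpow_add_of_nonneg (x := U x) _ _ hp1.le zero_le_one
        rwa [sub_add_cancel, ENNReal.rpow_one] at h1
      · refine le_trans ?_ (le_add_of_nonneg_right zero_le)
        simp only [hH', indicator_of_mem hx]
        exact ENNReal.rpow_le_rpow (not_lt.1 hM') (by linarith)
    · rw [h0 x hx, ENNReal.zero_rpow_of_pos (by linarith)]; exact zero_le
  -- Any exponent above d/(d-μ) would do; the bounded part of U^p lies in all of them, so its
  -- potential is bounded by a constant L.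
  set tt := 2 * (d / (d - mu)) + 1 with htt
  have hdm : 0 < d - mu := by linarith
  have htt1 : 1 < tt := by rw [htt]; have : 0 < d / (d - mu) := by positivity
                           linarith
  obtain ⟨L, hL, HL⟩ := exists_rieszPot_le_const (E := E) (a := mu) (t := tt) (by omega) hmu0.le
    htt1 (by
      rw [div_lt_div_iff₀ (by linarith) hdp, htt]
      have : d / (d - mu) * (d - mu) = d := div_mul_cancel₀ _ hdm.ne'
      nlinarith) hΩ hv hH'm (fun x hx => indicator_of_notMem hx _)
    (lrNorm_indicator_const_ne_top hΩ hv (ENNReal.rpow_ne_top_of_nonneg (by linarith)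
      (ENNReal.natCast_ne_top M)) (by linarith))
  set g : E → ℝ≥0∞ := fun x => Ω.indicator (fun _ => C₀) x + C * (L * rieszPot (d - 2) K x) with hg
  have hgm : Measurable g := (measurable_const.indicator hΩ).add
    (((measurable_rieszPot _ hKm).const_mul _).const_mul _)
  have hr1' : 1 ≤ r := by
    have : 1 / r < 1 := hr2.trans (by rw [div_lt_one (by positivity)]; linarith)
    rw [div_lt_one hr] at this; exact this.le
  refine lrNorm_ne_top_of_le_add (T := T) hs0 hr1' (fun v hv => ?_) (fun v w hvw x => ?_)
    (fun v w hv hw x => ?_) (hTnorm s hs0 B (le_add_of_nonneg_left zero_le) fun v hv => HB H K v hHm hKm hv)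
    (hTnorm r hr A (le_add_of_nonneg_right zero_le) fun v hv => HA H K v hHm hKm hv)
    hU hgm hUs ?_ ?_
  · exact (measurable_rieszPot _ (hin v hv)).const_mul _
  · refine mul_le_mul_right (rieszPot_mono _ (Eventually.of_forall fun y => ?_) x) _
    refine mul_le_mul_left (rieszPot_mono _ ?_ y) _
    filter_upwards [hvw] with z hz
    gcongr
  · simp only [hT]
    rw [← mul_add, ← rieszPot_add _ (hin v hv)]
    congr 2; ext y
    have h1 := rieszPot_add mu (show Measurable fun x => H x * v x from hHm.mul hv)
      (fun x => H x * w x) y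
    rw [← add_mul, ← h1]
    simp_rw [mul_add]
  · have a1 := lrNorm_indicator_const_ne_top hΩ hv hC₀ hr
    -- The lower bound on 1/r enters here: it says 1/q ≤ 1/r + 2/d, so K ∈ L^q lies in the space
    -- which the potential of order two maps to L^r.
    have a2 : lrNorm r (rieszPot (d - 2) K) ≠ ⊤ := by
      set t := 1 / (1 / r + 2 / d) with ht
      have hr0 : 0 < 1 / r := by positivity
      have ht0 : 0 < t := by positivity
      have et : 1 / t = 1 / r + 2 / d := one_div_one_div _
      have hsum : (d - 2) / (2 * d) + 2 / d < 1 := by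
        rw [hd2d, ← add_div, div_lt_one (by positivity)]; linarith
      refine lrNorm_rieszPot_ne_top (by omega) (r := t) (by linarith)
        (one_lt_one_div (by positivity) (by linarith)) hr (by rw [et]; ring) hKm ?_
      refine lrNorm_ne_top_of_le hΩ hv (fun x hx => ?_) ht0 ?_ hKq
      · rw [hK]; simp [h0 x hx, hp1]
      · refine (one_div_le_one_div hq0 ht0).1 ?_
        rw [eq1, et, hd2d]
        have : (d - mu + 2) / (2 * d) = (d - mu - 2) / (2 * d) + 4 / (2 * d) := by
          rw [← add_div]; ring
        linarith
    refine ne_top_of_le_ne_top ?_ (lrNorm_add_le hr1' (measurable_const.indicator hΩ)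
      (((measurable_rieszPot _ hKm).const_mul _).const_mul _))
    rw [lrNorm_const_mul hr _ ((measurable_rieszPot _ hKm).const_mul _),
      lrNorm_const_mul hr _ (measurable_rieszPot _ hKm)]
    finiteness
  · filter_upwards [hle] with x hx
    refine hx.trans ?_
    rw [hg, hT, add_assoc, ← mul_add, ← rieszPot_const_mul _ _ hKm, ← rieszPot_add _ (hKm.const_mul L)]
    refine add_le_add le_rfl (mul_le_mul_right (rieszPot_mono _ (Eventually.of_forall fun y => ?_) x) _)
    rw [← add_mul]
    refine mul_le_mul_left ?_ _
    refine (rieszPot_mono mu (Eventually.of_forall hsplit) y).trans ?_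
    rw [rieszPot_add _ hH'm]
    exact add_le_add (HL y) le_rfl

/-- Subcritical bootstrap. -/
theorem lrNorm_ne_top_of_le_rieszPot_rpow (hd : 3 ≤ finrank ℝ E) {b : ℝ} (hb1 : 1 ≤ b)
    (hb : b * (finrank ℝ E - 2) < finrank ℝ E + 2)
    {Ω : Set E} (hΩ : MeasurableSet Ω) (hv : volume Ω ≠ ⊤) {U : E → ℝ≥0∞} (hU : Measurable U)
    (h0 : ∀ x ∉ Ω, U x = 0)
    (hUs : lrNorm (2 * finrank ℝ E / (finrank ℝ E - 2)) U ≠ ⊤)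
    {C₀ C : ℝ≥0∞} (hC₀ : C₀ ≠ ⊤) (hC : C ≠ ⊤)
    (hle : ∀ᵐ x, U x ≤ Ω.indicator (fun _ => C₀) x
      + C * rieszPot (finrank ℝ E - 2) (fun y => U y ^ b) x) {s : ℝ} (hs : 0 < s) :
    lrNorm s U ≠ ⊤ := by
  set d : ℝ := (finrank ℝ E : ℝ) with hd_def
  have hd3 : (3 : ℝ) ≤ d := by rw [hd_def]; exact_mod_cast hd
  have hdp : 0 < d := by linarith
  have hd2 : 0 < d - 2 := by linarith
  set k₀ := (d - 2) / (2 * d) with hk₀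
  have hk₀p : 0 < k₀ := by positivity
  have es : 1 / (2 * d / (d - 2)) = k₀ := one_div_div _ _
  -- δ is the decrease of the reciprocal exponent in one round. It is positive precisely because b <
  -- (d+2)/(d-2).
  set δ := 2 / d - (b - 1) * k₀ with hδ
  have hδp : 0 < δ := by
    have h1 : (b - 1) * (d - 2) < 4 := by linarith
    have : (b - 1) * k₀ = ((b - 1) * (d - 2)) / (2 * d) := by rw [hk₀]; ring
    have h2 : 2 / d = 4 / (2 * d) := by field_simp; norm_num
    rw [hδ, this, h2, sub_pos]
    gcongr
  have hsum : k₀ + 2 / d < 1 := by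
    have h2 : 2 / d = 4 / (2 * d) := by field_simp; norm_num
    rw [hk₀, h2, ← add_div, div_lt_one (by positivity)]; linarith
  have base : ∀ s : ℝ, 0 < s → k₀ ≤ 1 / s → lrNorm s U ≠ ⊤ := by
    intro s hs hks
    refine lrNorm_ne_top_of_le hΩ hv h0 hs ?_ hUs
    exact (one_div_le_one_div (by positivity) hs).1 (by rwa [es])
  have main : ∀ j : ℕ, ∀ s : ℝ, 0 < s → k₀ - j * δ ≤ 1 / s → lrNorm s U ≠ ⊤ := by
    intro j
    induction j with
    | zero => intro s hs h; exact base s hs (by simpa using h)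
    | succ j ih =>
      intro s hs h
      by_cases hk : k₀ ≤ 1 / s
      · exact base s hs hk
      push Not at hk
      have hs0 : 0 < 1 / s := by positivity
      -- The cap k₀ bounds the surplus: b/r = 1/r + (b-1)/r ≤ (1/s + δ) + (b-1)k₀ = 1/s + 2/d, which
      -- is what the potential of order two needs to reach L^s.
      set r := 1 / min (1 / s + δ) k₀ with hr
      have hr0 : 0 < r := by positivity
      have er : 1 / r = min (1 / s + δ) k₀ := one_div_one_div _
      have hUr : lrNorm r U ≠ ⊤ := by
        refine ih r hr0 ?_
        rw [er, le_min_iff]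
        push_cast at h
        constructor
        · linarith
        · have : 0 ≤ j * δ := by positivity
          linarith
      have hb0 : 0 < b := by linarith
      have h1 := lrNorm_rpow_ne_top hr0 hb0 hUr
      set t := 1 / (1 / s + 2 / d) with ht
      have ht0 : 0 < t := by positivity
      have et : 1 / t = 1 / s + 2 / d := one_div_one_div _
      have hs1 : 1 ≤ s := by
        have : 1 / s < 1 := by
          have : 0 < 2 / d := by positivity
          linarith
        rw [div_lt_one hs] at this; exact this.le
      have h2 : lrNorm t (fun y => U y ^ b) ≠ ⊤ := by
        refine lrNorm_ne_top_of_le hΩ hv (fun x hx => ?_) ht0 ?_ h1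
        · simp [h0 x hx, hb0]
        · refine (one_div_le_one_div (by positivity) ht0).1 ?_
          rw [one_div_div, et]
          have e1 : b / r = b * (1 / r) := by ring
          rw [e1, er]
          have m1 := min_le_left (1 / s + δ) k₀
          have m2 := min_le_right (1 / s + δ) k₀
          have : (b - 1) * min (1 / s + δ) k₀ ≤ (b - 1) * k₀ :=
            mul_le_mul_of_nonneg_left m2 (by linarith)
          rw [hδ] at m1 this
          rw [hδ]
          linarith
      have h3 : lrNorm s (rieszPot (d - 2) (fun y => U y ^ b)) ≠ ⊤ :=
        lrNorm_rieszPot_ne_top (by omega) (r := t) (by linarith)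
          (one_lt_one_div (by positivity) (by linarith)) hs (by rw [et]; ring)
          (hU.pow_const b) h2
      have hm := measurable_rieszPot (d - 2) (hU.pow_const b)
      refine ne_top_of_le_ne_top ?_ ((lrNorm_mono hs hle).trans
        (lrNorm_add_le hs1 (measurable_const.indicator hΩ) (hm.const_mul C)))
      rw [lrNorm_const_mul hs _ hm]
      have h4 := lrNorm_indicator_const_ne_top hΩ hv hC₀ hs
      finiteness
  obtain ⟨j, hj⟩ := exists_nat_gt (k₀ / δ)
  refine main j s hs ?_
  rw [div_lt_iff₀ hδp] at hj
  have : 0 < 1 / s := by positivity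
  linarith

/-- `L^s` regularity, for all `s`, for the critical Choquard integral inequality. -/
theorem lrNorm_ne_top_of_le_choquard_all (hd : 3 ≤ finrank ℝ E) {mu p : ℝ} (hmu0 : 0 < mu)
    (hmu : mu < finrank ℝ E) (hp : p * (finrank ℝ E - 2) = 2 * finrank ℝ E - mu)
    {Ω : Set E} (hΩ : MeasurableSet Ω) (hv : volume Ω ≠ ⊤) {U : E → ℝ≥0∞} (hU : Measurable U)
    (h0 : ∀ x ∉ Ω, U x = 0)
    (hUs : lrNorm (2 * finrank ℝ E / (finrank ℝ E - 2)) U ≠ ⊤)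
    {C₀ C : ℝ≥0∞} (hC₀ : C₀ ≠ ⊤) (hC : C ≠ ⊤)
    (hle : ∀ᵐ x, U x ≤ Ω.indicator (fun _ => C₀) x
      + C * rieszPot (finrank ℝ E - 2) (fun y => rieszPot mu (fun x => U x ^ p) y * U y ^ (p - 1)) x)
    {s : ℝ} (hs : 0 < s) : lrNorm s U ≠ ⊤ := by
  set d : ℝ := (finrank ℝ E : ℝ) with hd_def
  have hd3 : (3 : ℝ) ≤ d := by rw [hd_def]; exact_mod_cast hd
  have hdp : 0 < d := by linarith
  have hd2 : 0 < d - 2 := by linarith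
  have hdm : 0 < d - mu := by linarith
  have hpe : p = (2 * d - mu) / (d - 2) := by rw [eq_div_iff hd2.ne', hp]
  have hp1 : 0 < p - 1 := by
    have : p - 1 = (d - mu + 2) / (d - 2) := by rw [hpe]; field_simp; ring
    rw [this]; exact div_pos (by linarith) hd2
  have hp0 : 0 < p := by linarith
  -- boundedness of the convolution term
  have hlow : max 0 ((d - mu - 2) / (2 * d)) < (d - mu) / (d * p) := by
    have hdpp : 0 < d * p := by positivity
    refine max_lt (div_pos hdm hdpp) ?_
    rw [div_lt_div_iff₀ (by positivity) hdpp]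
    have h1 : (d - mu - 2) * p < (d - mu) * 2 := by
      rw [hpe, mul_div_assoc', div_lt_iff₀ hd2]
      nlinarith [mul_pos (show 0 < d - mu + 2 by linarith) hmu0]
    nlinarith
  have hup : (d - mu) / (d * p) < (d - 2) / (2 * d) := by
    rw [div_lt_div_iff₀ (by positivity) (by positivity)]
    have : (d - 2) * (d * p) = d * (2 * d - mu) := by rw [← hp]; ring
    rw [this]; nlinarith
  obtain ⟨k, hk1, hk2⟩ := exists_between hlow
  have hk0 : 0 < k := (le_max_left _ _).trans_lt hk1
  have hUr : lrNorm (1 / k) U ≠ ⊤ := by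
    refine lrNorm_ne_top_of_le_choquard hd hmu0 hmu hp hΩ hv hU h0 hUs hC₀ hC hle (by positivity)
      ?_ ?_ <;> rw [one_div_one_div]
    · exact (le_max_right _ _).trans_lt hk1
    · exact hk2.trans hup
  have hUp := lrNorm_rpow_ne_top (by positivity) hp0 hUr
  have hkp : k * p < (d - mu) / d := by
    rw [← div_div, lt_div_iff₀ hp0] at hk2; exact hk2
  have e1 : 1 / k / p = 1 / (k * p) := div_div _ _ _
  rw [e1] at hUp
  have hkp1 : k * p < 1 := hkp.trans (by rw [div_lt_one hdp]; linarith)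
  obtain ⟨M, hM, HM⟩ := exists_rieszPot_le_const (E := E) (a := mu) (by omega) hmu0.le
    (one_lt_one_div (by positivity) hkp1) (by rwa [one_div_one_div]) hΩ hv (hU.pow_const p)
    (fun x hx => by simp [h0 x hx, hp0]) hUp
  obtain ⟨M', hM', HM'⟩ := exists_rieszPot_le_const (E := E) (a := d - 2) (t := d) (by omega)
    hd2.le (by linarith) (by gcongr ?_ / _; linarith) hΩ hv
    (measurable_const.indicator hΩ)
    (fun x hx => indicator_of_notMem hx _) (lrNorm_indicator_const_ne_top hΩ hv ENNReal.one_ne_top hdp)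
  -- The bootstrap requires b ≥ 1, while p - 1 may be smaller; U^{p-1} ≤ 1 + U^b on Ω, and the
  -- constant has the bounded potential M'. Subcriticality of p - 1 amounts to μ > 0.
  set b := max (p - 1) 1 with hb
  have hb1 : 1 ≤ b := le_max_right _ _
  have hI : Measurable (Ω.indicator fun _ => (1 : ℝ≥0∞)) := measurable_const.indicator hΩ
  have hsplit : ∀ y, rieszPot mu (fun x => U x ^ p) y * U y ^ (p - 1)
      ≤ M * (Ω.indicator (fun _ => 1) y + U y ^ b) := by
    intro y
    refine mul_le_mul' (HM y) ?_
    by_cases hy : y ∈ Ω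
    · rw [indicator_of_mem hy]
      rcases le_total (U y) 1 with h1 | h1
      · exact (ENNReal.rpow_le_one h1 hp1.le).trans (le_add_of_nonneg_right zero_le)
      · exact (ENNReal.rpow_le_rpow_of_exponent_le h1 (le_max_left _ _)).trans
          (le_add_of_nonneg_left zero_le)
    · simp [h0 y hy, hp1]
  have hbase : ∀ᵐ x, U x ≤ C₀ + C * (M * M') + C * M * rieszPot (d - 2) (fun y => U y ^ b) x := by
    filter_upwards [hle] with x hx
    refine hx.trans ?_
    rw [add_assoc]
    refine add_le_add (indicator_le_self' (fun _ _ => zero_le) x) ?_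
    refine (mul_le_mul_right (rieszPot_mono _ (Eventually.of_forall hsplit) x) C).trans ?_
    have hm : Measurable fun y => Ω.indicator (fun _ => (1 : ℝ≥0∞)) y + U y ^ b :=
      hI.add (hU.pow_const b)
    rw [rieszPot_const_mul _ _ hm, rieszPot_add _ hI, mul_add, mul_add]
    exact add_le_add (mul_le_mul_right (mul_le_mul_right (HM' x) _) _) (mul_assoc _ _ _).ge
  refine lrNorm_ne_top_of_le_rieszPot_rpow hd hb1 ?_ hΩ hv hU h0 hUs (C₀ := C₀ + C * (M * M'))
    (C := C * M) (by finiteness) (by finiteness) ?_ hs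
  · rw [hb]
    rcases max_choice (p - 1) 1 with h | h <;> rw [h]
    · have : (p - 1) * (d - 2) = d - mu + 2 := by linarith
      rw [this]; linarith
    · linarith
  · filter_upwards [hbase] with x hx
    by_cases hxΩ : x ∈ Ω
    · rwa [indicator_of_mem hxΩ]
    · rw [h0 x hxΩ]; exact zero_le

end IntegralRegularity

/-! ### The truncation and its primitive. -/

section Cutoff

/-- A smooth nondecreasing (on `[0, ∞)`) truncation, vanishing quadratically at the origin. -/
noncomputable def cutoff (t : ℝ) : ℝ := t ^ 2 / (1 + t ^ 2)

/-- The primitive of `cutoff ^ 2` vanishing at the origin. -/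
noncomputable def cutoffPrim (t : ℝ) : ℝ := t - 3 / 2 * Real.arctan t + t / (2 * (1 + t ^ 2))

theorem cutoff_nonneg (t : ℝ) : 0 ≤ cutoff t := by unfold cutoff; positivity

theorem cutoff_le_one (t : ℝ) : cutoff t ≤ 1 := by
  unfold cutoff; rw [div_le_one (by positivity)]; linarith

theorem abs_cutoff_le_one (t : ℝ) : |cutoff t| ≤ 1 := by
  rw [abs_of_nonneg (cutoff_nonneg t)]; exact cutoff_le_one t

theorem cutoff_zero : cutoff 0 = 0 := by simp [cutoff]

theorem contDiff_cutoff {m : WithTop ℕ∞} : ContDiff ℝ m cutoff := by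
  unfold cutoff
  exact (contDiff_id.pow 2).div (contDiff_const.add (contDiff_id.pow 2)) fun x => by positivity

theorem hasDerivAt_cutoff (t : ℝ) : HasDerivAt cutoff (2 * t / (1 + t ^ 2) ^ 2) t := by
  have h1 : HasDerivAt (fun t : ℝ => t ^ 2) (2 * t) t := by simpa using hasDerivAt_pow 2 t
  have h := h1.div (h1.const_add 1) (by positivity)
  refine h.congr_deriv ?_
  field_simp
  ring

theorem deriv_cutoff (t : ℝ) : deriv cutoff t = 2 * t / (1 + t ^ 2) ^ 2 := (hasDerivAt_cutoff t).deriv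

theorem deriv_cutoff_nonneg {t : ℝ} (ht : 0 ≤ t) : 0 ≤ deriv cutoff t := by
  rw [deriv_cutoff]; positivity

theorem abs_deriv_cutoff_le_one (t : ℝ) : |deriv cutoff t| ≤ 1 := by
  rw [deriv_cutoff, abs_div, abs_of_pos (show 0 < (1 + t ^ 2) ^ 2 by positivity),
    div_le_one (by positivity), abs_le]
  constructor <;> nlinarith [sq_nonneg (t - 1), sq_nonneg (t + 1), sq_nonneg (t ^ 2), sq_nonneg t]

theorem continuous_deriv_cutoff : Continuous (deriv cutoff) :=
  contDiff_cutoff.continuous_deriv (n := 1) le_rfl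

/-- Vanishing at the origin beats the singularity: for t ≤ 1 one has t^{-q} ≤ 1/t and `cutoff t ≤
t`; for t ≥ 1 both factors are at most 1. -/
theorem cutoff_mul_rpow_neg_le_one {t q : ℝ} (ht : 0 < t) (hq0 : 0 < q) (hq1 : q < 1) :
    t ^ (-q) * cutoff t ≤ 1 := by
  rcases le_total t 1 with h | h
  · have h1 : t ^ (-q) ≤ t ^ (-1 : ℝ) := Real.rpow_le_rpow_of_exponent_ge ht h (by linarith)
    have h2 : cutoff t ≤ t := by
      unfold cutoff; rw [div_le_iff₀ (by positivity)]; nlinarith [sq_nonneg t, mul_pos ht ht]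
    calc _ ≤ t ^ (-1 : ℝ) * t := mul_le_mul h1 h2 (cutoff_nonneg t) (by positivity)
      _ = 1 := by rw [Real.rpow_neg_one, inv_mul_cancel₀ ht.ne']
  · have h1 : t ^ (-q) ≤ 1 := Real.rpow_le_one_of_one_le_of_nonpos h (by linarith)
    exact mul_le_one₀ h1 (cutoff_nonneg t) (cutoff_le_one t)

theorem contDiff_cutoffPrim {m : WithTop ℕ∞} : ContDiff ℝ m cutoffPrim := by
  unfold cutoffPrim
  refine (contDiff_id.sub (contDiff_const.mul Real.contDiff_arctan)).add ?_
  exact contDiff_id.div (contDiff_const.mul (contDiff_const.add (contDiff_id.pow 2)))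
    fun x => by positivity

theorem hasDerivAt_cutoffPrim (t : ℝ) : HasDerivAt cutoffPrim (cutoff t ^ 2) t := by
  have h1 : HasDerivAt (fun t : ℝ => 2 * (1 + t ^ 2)) (2 * (2 * t)) t := by
    have : HasDerivAt (fun t : ℝ => t ^ 2) (2 * t) t := by simpa using hasDerivAt_pow 2 t
    exact (this.const_add 1).const_mul 2
  have h := ((hasDerivAt_id t).sub ((Real.hasDerivAt_arctan t).const_mul (3 / 2))).add
    ((hasDerivAt_id t).div h1 (by positivity))
  refine h.congr_deriv ?_
  simp only [cutoff, id]
  field_simp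
  ring

theorem cutoffPrim_zero : cutoffPrim 0 = 0 := by simp [cutoffPrim]

theorem monotone_cutoffPrim : Monotone cutoffPrim :=
  monotone_of_deriv_nonneg (fun t => (hasDerivAt_cutoffPrim t).differentiableAt) fun t => by
    rw [(hasDerivAt_cutoffPrim t).deriv]; positivity

theorem cutoffPrim_nonneg {t : ℝ} (ht : 0 ≤ t) : 0 ≤ cutoffPrim t := by
  rw [← cutoffPrim_zero]; exact monotone_cutoffPrim ht

/-- The loss is at most (3/2) arctan t < 3π/4 < 3. Hence an upper bound for `cutoffPrim u` carries
over to u up to a constant. -/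
theorem le_cutoffPrim_add {t : ℝ} (ht : 0 ≤ t) : t ≤ 3 + cutoffPrim t := by
  have h1 := Real.arctan_lt_pi_div_two t
  have h2 := Real.pi_lt_four
  have h3 : 0 ≤ t / (2 * (1 + t ^ 2)) := by positivity
  unfold cutoffPrim; linarith

theorem abs_cutoffPrim_sub_le (s t : ℝ) : |cutoffPrim s - cutoffPrim t| ≤ |s - t| := by
  have h := lipschitzWith_of_nnnorm_deriv_le (C := 1)
    (fun t => (hasDerivAt_cutoffPrim t).differentiableAt) fun t => by
      rw [(hasDerivAt_cutoffPrim t).deriv, ← NNReal.coe_le_coe, coe_nnnorm, Real.norm_of_nonneg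
        (by positivity), NNReal.coe_one]
      exact pow_le_one₀ (cutoff_nonneg t) (cutoff_le_one t)
  simpa [Real.dist_eq] using h.dist_le_mul s t

end Cutoff

/-! ### Passage to the limit in products. -/

section Limits

open scoped ENNReal

variable {α F : Type*} [MeasurableSpace α] {ν : Measure α} [NormedAddCommGroup F]
  [InnerProductSpace ℝ F]

theorem eLpNorm_inner_le {A B : α → F} (hA : AEStronglyMeasurable A ν)
    (hB : AEStronglyMeasurable B ν) :
    eLpNorm (fun x => inner ℝ (A x) (B x)) 1 ν ≤ eLpNorm A 2 ν * eLpNorm B 2 ν := by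
  have h := eLpNorm_le_eLpNorm_mul_eLpNorm_of_nnnorm (p := 2) (q := 2) (r := 1) hA hB
    (fun a b => inner ℝ a b) 1 (Eventually.of_forall fun x => by
      rw [one_mul]; exact nnnorm_inner_le_nnnorm _ _)
  simpa using h

theorem integrable_inner_of_memLp_two {A B : α → F} (hA : MemLp A 2 ν) (hB : MemLp B 2 ν) :
    Integrable (fun x => (inner ℝ (A x) (B x) : ℝ)) ν := by
  rw [← memLp_one_iff_integrable]
  exact ⟨hA.1.inner hB.1, (eLpNorm_inner_le hA.1 hB.1).trans_lt (ENNReal.mul_lt_top hA.2 hB.2)⟩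

theorem tendsto_integral_mul_of_bounded {m : ℕ → α → ℝ} {m' f : α → ℝ} {M : ℝ}
    (hm : ∀ k, AEStronglyMeasurable (m k) ν) (hM : ∀ k, ∀ᵐ x ∂ν, |m k x| ≤ M)
    (hlim : ∀ᵐ x ∂ν, Tendsto (fun k => m k x) atTop (𝓝 (m' x))) (hf : Integrable f ν) :
    Tendsto (fun k => ∫ x, m k x * f x ∂ν) atTop (𝓝 (∫ x, m' x * f x ∂ν)) := by
  refine tendsto_integral_of_dominated_convergence (fun x => M * |f x|)
    (fun k => (hm k).mul hf.1) (hf.abs.const_mul M) (fun k => ?_) ?_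
  · filter_upwards [hM k] with x hx
    rw [norm_mul, Real.norm_eq_abs, Real.norm_eq_abs]
    exact mul_le_mul_of_nonneg_right hx (abs_nonneg _)
  · filter_upwards [hlim] with x hx
    exact hx.mul_const _

/-- Weak-strong convergence: bounded a.e. convergent coefficients, `L²` convergent fields. -/
theorem tendsto_integral_mul_inner {m : ℕ → α → ℝ} {m' : α → ℝ} {M : ℝ} {A B : α → F}
    {Bk : ℕ → α → F}
    (hm : ∀ k, AEStronglyMeasurable (m k) ν) (hM : ∀ k, ∀ᵐ x ∂ν, |m k x| ≤ M)
    (hlim : ∀ᵐ x ∂ν, Tendsto (fun k => m k x) atTop (𝓝 (m' x))) (hA : MemLp A 2 ν)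
    (hB : MemLp B 2 ν) (hBk : ∀ k, MemLp (Bk k) 2 ν)
    (hBlim : Tendsto (fun k => eLpNorm (fun x => Bk k x - B x) 2 ν) atTop (𝓝 0)) :
    Tendsto (fun k => ∫ x, m k x * inner ℝ (A x) (Bk k x) ∂ν) atTop
      (𝓝 (∫ x, m' x * inner ℝ (A x) (B x) ∂ν)) := by
  have h1 := tendsto_integral_mul_of_bounded hm hM hlim (integrable_inner_of_memLp_two hA hB)
  have hint : ∀ k, Integrable (fun x => (inner ℝ (A x) (Bk k x - B x) : ℝ)) ν := fun k =>
    integrable_inner_of_memLp_two hA ((hBk k).sub hB)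
  have hmi : ∀ k (f : α → ℝ), Integrable f ν → Integrable (fun x => m k x * f x) ν := fun k f hf =>
    hf.bdd_mul (hm k) (by filter_upwards [hM k] with x hx using hx)
  -- Replacing `Bk k` by B costs at most M ‖A‖₂ ‖Bk - B‖₂; the other part converges by domination.
  have h2 : Tendsto (fun k => ∫ x, m k x * inner ℝ (A x) (Bk k x - B x) ∂ν) atTop (𝓝 0) := by
    rw [tendsto_iff_edist_tendsto_0]
    simp only [edist_zero_right]
    have hup : Tendsto (fun k => ENNReal.ofReal M * (eLpNorm A 2 ν *
        eLpNorm (fun x => Bk k x - B x) 2 ν)) atTop (𝓝 0) := by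
      have := ENNReal.Tendsto.const_mul (ENNReal.Tendsto.const_mul hBlim (Or.inr hA.2.ne))
        (Or.inr (ENNReal.ofReal_ne_top (r := M)))
      simpa using this
    refine tendsto_of_tendsto_of_tendsto_of_le_of_le tendsto_const_nhds hup (fun k => zero_le)
      fun k => ?_
    refine (enorm_integral_le_lintegral_enorm _).trans ?_
    calc _ ≤ ∫⁻ x, ENNReal.ofReal M * ‖(inner ℝ (A x) (Bk k x - B x) : ℝ)‖ₑ ∂ν := by
          refine lintegral_mono_ae ?_
          filter_upwards [hM k] with x hx
          rw [enorm_mul]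
          gcongr
          rw [Real.enorm_eq_ofReal_abs]
          exact ENNReal.ofReal_le_ofReal hx
      _ = ENNReal.ofReal M * eLpNorm (fun x => (inner ℝ (A x) (Bk k x - B x) : ℝ)) 1 ν := by
          rw [lintegral_const_mul' _ _ ENNReal.ofReal_ne_top, eLpNorm_one_eq_lintegral_enorm]
      _ ≤ _ := by
          gcongr
          exact eLpNorm_inner_le hA.1 ((hBk k).sub hB).1
  have h3 := h1.add h2
  rw [add_zero] at h3
  refine h3.congr fun k => ?_
  rw [← integral_add (hmi k _ (integrable_inner_of_memLp_two hA hB)) (hmi k _ (hint k))]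
  refine integral_congr_ae (Eventually.of_forall fun x => ?_)
  simp only [inner_sub_right]
  ring

end Limits

/-! ### From the weak equation to an inequality without singular term. -/

section WeakFormulation

variable {n : ℕ} {Ω : Set (EuclideanSpace ℝ (Fin n))}

theorem continuous_gradient {ζ : EuclideanSpace ℝ (Fin n) → ℝ} (hζ : ContDiff ℝ ∞ ζ) :
    Continuous (gradient ζ) :=
  (LinearIsometryEquiv.continuous _).comp (hζ.continuous_fderiv (by simp))

theorem IsTestFunction.memLp_gradient {φ : EuclideanSpace ℝ (Fin n) → ℝ} (hφ : IsTestFunction Ω φ) :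
    MemLp (gradient φ) 2 (volume.restrict Ω) := by
  refine MemLp.restrict Ω (Continuous.memLp_of_hasCompactSupport (continuous_gradient hφ.1) ?_)
  have := hφ.2.1.fderiv (𝕜 := ℝ)
  exact this.comp_left (g := (InnerProductSpace.toDual ℝ (EuclideanSpace ℝ (Fin n))).symm) (map_zero _)

/-- The compact support comes entirely from φ, because the truncation vanishes at 0; ζ need not
vanish near the boundary of Ω. -/
theorem IsTestFunction.mul_cutoff {φ ζ : EuclideanSpace ℝ (Fin n) → ℝ} (hφ : IsTestFunction Ω φ)
    (hζ : ContDiff ℝ ∞ ζ) : IsTestFunction Ω (fun y => ζ y * cutoff (φ y)) := by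
  have hc : HasCompactSupport (fun y => cutoff (φ y)) := hφ.2.1.comp_left cutoff_zero
  refine ⟨hζ.mul (contDiff_cutoff.comp hφ.1), hc.mul_left, ?_⟩
  refine (closure_mono fun y hy => ?_).trans hφ.2.2
  simp only [Function.mem_support] at hy ⊢
  intro h0
  exact hy (by rw [h0, cutoff_zero, mul_zero])

theorem inner_gradient_mul_cutoff {φ ζ : EuclideanSpace ℝ (Fin n) → ℝ} (hφ : ContDiff ℝ ∞ φ)
    (hζ : ContDiff ℝ ∞ ζ) (v x : EuclideanSpace ℝ (Fin n)) :
    inner ℝ v (gradient (fun y => ζ y * cutoff (φ y)) x)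
      = cutoff (φ x) * inner ℝ v (gradient ζ x)
        + ζ x * deriv cutoff (φ x) * inner ℝ v (gradient φ x) := by
  have h1 : HasFDerivAt ζ (fderiv ℝ ζ x) x := (hζ.differentiable (by simp) x).hasFDerivAt
  have h2 : HasFDerivAt φ (fderiv ℝ φ x) x := (hφ.differentiable (by simp) x).hasFDerivAt
  have h3 : HasFDerivAt (fun y => cutoff (φ y)) (deriv cutoff (φ x) • fderiv ℝ φ x) x := by
    have := (hasDerivAt_cutoff (φ x)).comp_hasFDerivAt x h2
    rwa [← deriv_cutoff] at this
  have h4 : fderiv ℝ (fun y => ζ y * cutoff (φ y)) x = _ := (h1.mul h3).fderiv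
  simp only [inner_gradient_right, h4]
  simp
  ring

theorem exists_bound_of_contDiff (hΩb : Bornology.IsBounded Ω)
    {ζ : EuclideanSpace ℝ (Fin n) → ℝ} (hζ : ContDiff ℝ ∞ ζ) :
    ∃ M, (∀ x ∈ Ω, |ζ x| ≤ M) ∧ ∀ x ∈ Ω, ‖gradient ζ x‖ ≤ M := by
  obtain ⟨M₁, h1⟩ := hΩb.isCompact_closure.exists_bound_of_continuousOn hζ.continuous.continuousOn
  obtain ⟨M₂, h2⟩ := hΩb.isCompact_closure.exists_bound_of_continuousOn
    (continuous_gradient hζ).continuousOn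
  exact ⟨max M₁ M₂, fun x hx => (h1 x (subset_closure hx)).trans (le_max_left _ _),
    fun x hx => (h2 x (subset_closure hx)).trans (le_max_right _ _)⟩

theorem memLp_gradient_of_contDiff (hΩo : IsOpen Ω) (hΩb : Bornology.IsBounded Ω) {ζ : EuclideanSpace ℝ (Fin n) → ℝ} (hζ : ContDiff ℝ ∞ ζ) :
    MemLp (gradient ζ) 2 (volume.restrict Ω) := by
  obtain ⟨M, -, hM⟩ := exists_bound_of_contDiff hΩb hζ
  have : IsFiniteMeasure (volume.restrict Ω) := ⟨by simpa using hΩb.measure_lt_top⟩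
  exact MemLp.of_bound (continuous_gradient hζ).aestronglyMeasurable M
    ((ae_restrict_iff' hΩo.measurableSet).2 (Eventually.of_forall hM))

/-- The product rule leaves bounded, almost everywhere convergent coefficients times a fixed L²
gradient or an L² convergent one. The field W is kept general: it is later taken to be G and then
`cutoff u` times G. -/
theorem tendsto_integral_inner_gradient_mul_cutoff (hΩo : IsOpen Ω) (hΩb : Bornology.IsBounded Ω)
    {u : EuclideanSpace ℝ (Fin n) → ℝ} {G W : EuclideanSpace ℝ (Fin n) → EuclideanSpace ℝ (Fin n)}
    {φ : ℕ → EuclideanSpace ℝ (Fin n) → ℝ} (hφ : ∀ k, IsTestFunction Ω (φ k))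
    (hφu : ∀ᵐ x ∂(volume.restrict Ω), Tendsto (fun k => φ k x) atTop (𝓝 (u x)))
    (hG : MemLp G 2 (volume.restrict Ω)) (hW : MemLp W 2 (volume.restrict Ω))
    (hφG : Tendsto (fun k => eLpNorm (fun x => gradient (φ k) x - G x) 2 (volume.restrict Ω))
      atTop (𝓝 0)) {ζ : EuclideanSpace ℝ (Fin n) → ℝ} (hζ : ContDiff ℝ ∞ ζ) :
    Tendsto (fun k => ∫ x in Ω, inner ℝ (W x) (gradient (fun y => ζ y * cutoff (φ k y)) x)) atTop
      (𝓝 ((∫ x in Ω, cutoff (u x) * inner ℝ (W x) (gradient ζ x))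
        + ∫ x in Ω, ζ x * deriv cutoff (u x) * inner ℝ (W x) (G x))) := by
  obtain ⟨M, hM, -⟩ := exists_bound_of_contDiff hΩb hζ
  have hgζ := memLp_gradient_of_contDiff hΩo hΩb hζ
  have hc1 : ∀ k, Continuous fun x => cutoff (φ k x) := fun k =>
    (contDiff_cutoff (m := 0)).continuous.comp (hφ k).1.continuous
  have hc2 : ∀ k, Continuous fun x => ζ x * deriv cutoff (φ k x) := fun k =>
    hζ.continuous.mul (continuous_deriv_cutoff.comp (hφ k).1.continuous)
  have hM' : ∀ k, ∀ᵐ x ∂(volume.restrict Ω), |ζ x * deriv cutoff (φ k x)| ≤ M := fun k =>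
    (ae_restrict_iff' hΩo.measurableSet).2 (Eventually.of_forall fun x hx => by
      rw [abs_mul]
      exact (mul_le_of_le_one_right (abs_nonneg _) (abs_deriv_cutoff_le_one _)).trans (hM x hx))
  have h1 := tendsto_integral_mul_of_bounded (ν := volume.restrict Ω) (M := 1)
    (m := fun k x => cutoff (φ k x)) (m' := fun x => cutoff (u x))
    (fun k => (hc1 k).aestronglyMeasurable)
    (fun k => Eventually.of_forall fun x => abs_cutoff_le_one _)
    (by
      filter_upwards [hφu] with x hx
      exact ((contDiff_cutoff (m := 0)).continuous.tendsto _).comp hx)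
    (integrable_inner_of_memLp_two hW hgζ)
  have h2 := tendsto_integral_mul_inner (ν := volume.restrict Ω) (M := M)
    (m := fun k x => ζ x * deriv cutoff (φ k x)) (m' := fun x => ζ x * deriv cutoff (u x))
    (fun k => (hc2 k).aestronglyMeasurable) hM'
    (by
      filter_upwards [hφu] with x hx
      exact ((continuous_deriv_cutoff.tendsto _).comp hx).const_mul _)
    hW hG (fun k => (hφ k).memLp_gradient) hφG
  refine (h1.add h2).congr fun k => ?_
  rw [← integral_add]
  · refine integral_congr_ae (Eventually.of_forall fun x => ?_)
    exact (inner_gradient_mul_cutoff (hφ k).1 hζ _ _).symm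
  · exact (integrable_inner_of_memLp_two hW hgζ).bdd_mul (c := 1) (hc1 k).aestronglyMeasurable
      (Eventually.of_forall fun x => abs_cutoff_le_one _)
  · exact (integrable_inner_of_memLp_two hW (hφ k).memLp_gradient).bdd_mul
      (hc2 k).aestronglyMeasurable (hM' k)

/-- Truncation removes the singular term: `-Δu ≤ λ + N` where `u` is large. -/
theorem integral_cutoff_mul_inner_le (hΩo : IsOpen Ω) (hΩb : Bornology.IsBounded Ω)
    {u N : EuclideanSpace ℝ (Fin n) → ℝ} {G : EuclideanSpace ℝ (Fin n) → EuclideanSpace ℝ (Fin n)}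
    {lam q : ℝ} (hlam : 0 < lam) (hq0 : 0 < q) (hq1 : q < 1)
    {φ : ℕ → EuclideanSpace ℝ (Fin n) → ℝ} (hφ : ∀ k, IsTestFunction Ω (φ k))
    (hφu : ∀ᵐ x ∂(volume.restrict Ω), Tendsto (fun k => φ k x) atTop (𝓝 (u x)))
    (hu : ∀ᵐ x ∂(volume.restrict Ω), 0 < u x)
    (hG : MemLp G 2 (volume.restrict Ω))
    (hφG : Tendsto (fun k => eLpNorm (fun x => gradient (φ k) x - G x) 2 (volume.restrict Ω))
      atTop (𝓝 0))
    (hN : IntegrableOn N Ω) (hN0 : ∀ᵐ x ∂(volume.restrict Ω), 0 ≤ N x)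
    (hweak : ∀ ψ : EuclideanSpace ℝ (Fin n) → ℝ, IsTestFunction Ω ψ →
      IntegrableOn (fun x => u x ^ (-q) * ψ x) Ω ∧
      (∫ x in Ω, (inner ℝ (G x) (gradient ψ x) - lam * u x ^ (-q) * ψ x)) - (∫ x in Ω, N x * ψ x)
        = 0)
    {ζ : EuclideanSpace ℝ (Fin n) → ℝ} (hζ : IsTestFunction Ω ζ) (hζ0 : ∀ x, 0 ≤ ζ x) :
    ∫ x in Ω, cutoff (u x) * inner ℝ (G x) (gradient ζ x) ≤ ∫ x in Ω, (lam + N x) * ζ x := by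
  have hfin : IsFiniteMeasure (volume.restrict Ω) := ⟨by simpa using hΩb.measure_lt_top⟩
  obtain ⟨M, hM, -⟩ := exists_bound_of_contDiff hΩb hζ.1
  have hMae : ∀ᵐ x ∂(volume.restrict Ω), ‖ζ x‖ ≤ M :=
    (ae_restrict_iff' hΩo.measurableSet).2 (Eventually.of_forall hM)
  have hNζ : Integrable (fun x => N x * ζ x) (volume.restrict Ω) :=
    hN.mul_bdd hζ.1.continuous.aestronglyMeasurable hMae
  have hζi : Integrable ζ (volume.restrict Ω) :=
    Integrable.of_bound hζ.1.continuous.aestronglyMeasurable M hMae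
  -- Integrability of u^{-q} ζ, part of the definition of a solution, justifies the limit in the
  -- singular term with coefficients bounded by 1.
  have hsing := (hweak ζ hζ).1
  have hc1 : ∀ k, Continuous fun x => cutoff (φ k x) := fun k =>
    (contDiff_cutoff (m := 0)).continuous.comp (hφ k).1.continuous
  have hclim : ∀ᵐ x ∂(volume.restrict Ω), Tendsto (fun k => cutoff (φ k x)) atTop
      (𝓝 (cutoff (u x))) := by
    filter_upwards [hφu] with x hx
    exact ((contDiff_cutoff (m := 0)).continuous.tendsto _).comp hx
  have hL := tendsto_integral_inner_gradient_mul_cutoff hΩo hΩb hφ hφu hG hG hφG hζ.1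
  have hR1 := tendsto_integral_mul_of_bounded (ν := volume.restrict Ω) (M := 1)
    (m := fun k x => cutoff (φ k x)) (m' := fun x => cutoff (u x))
    (fun k => (hc1 k).aestronglyMeasurable)
    (fun k => Eventually.of_forall fun x => abs_cutoff_le_one _) hclim hsing
  have hR2 := tendsto_integral_mul_of_bounded (ν := volume.restrict Ω) (M := 1)
    (m := fun k x => cutoff (φ k x)) (m' := fun x => cutoff (u x))
    (fun k => (hc1 k).aestronglyMeasurable)
    (fun k => Eventually.of_forall fun x => abs_cutoff_le_one _) hclim hNζ
  have hEq : ∀ k, ∫ x in Ω, inner ℝ (G x) (gradient (fun y => ζ y * cutoff (φ k y)) x)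
      = lam * (∫ x in Ω, cutoff (φ k x) * (u x ^ (-q) * ζ x))
        + ∫ x in Ω, cutoff (φ k x) * (N x * ζ x) := by
    intro k
    have ht := (hφ k).mul_cutoff hζ.1
    obtain ⟨i1, i2⟩ := hweak _ ht
    have i1' : Integrable (fun x => lam * u x ^ (-q) * (ζ x * cutoff (φ k x)))
        (volume.restrict Ω) := by
      refine (i1.const_mul lam).congr (Eventually.of_forall fun x => ?_)
      simp only; ring
    rw [integral_sub (integrable_inner_of_memLp_two hG ht.memLp_gradient) i1', sub_sub,
      sub_eq_zero] at i2
    rw [i2, ← integral_const_mul]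
    congr 1 <;> refine integral_congr_ae (Eventually.of_forall fun x => ?_) <;> simp only <;> ring
  have hlim := tendsto_nhds_unique (hL.congr hEq) ((hR1.const_mul lam).add hR2)
  -- The term in which the derivative falls on the truncation has a favourable sign and is
  -- discarded, which turns the equation into an inequality.
  have hpos : 0 ≤ ∫ x in Ω, ζ x * deriv cutoff (u x) * inner ℝ (G x) (G x) := by
    refine integral_nonneg_of_ae ?_
    filter_upwards [hu] with x hx
    exact mul_nonneg (mul_nonneg (hζ0 x) (deriv_cutoff_nonneg hx.le)) real_inner_self_nonneg
  have hle : lam * (∫ x in Ω, cutoff (u x) * (u x ^ (-q) * ζ x))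
      + ∫ x in Ω, cutoff (u x) * (N x * ζ x) ≤ ∫ x in Ω, (lam + N x) * ζ x := by
    simp_rw [add_mul]
    rw [integral_add (hζi.const_mul lam) hNζ, integral_const_mul]
    refine add_le_add (mul_le_mul_of_nonneg_left ?_ hlam.le) ?_
    · refine integral_mono_of_nonneg ?_ hζi ?_
      · filter_upwards [hu] with x hx
        exact mul_nonneg (cutoff_nonneg _) (mul_nonneg (Real.rpow_nonneg hx.le _) (hζ0 x))
      · filter_upwards [hu] with x hx
        have := mul_le_mul_of_nonneg_right (cutoff_mul_rpow_neg_le_one hx hq0 hq1) (hζ0 x)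
        linarith
    · refine integral_mono_of_nonneg ?_ hNζ ?_
      · filter_upwards [hN0] with x hx
        exact mul_nonneg (cutoff_nonneg _) (mul_nonneg hx (hζ0 x))
      · filter_upwards [hN0] with x hx
        exact mul_le_of_le_one_left (mul_nonneg hx (hζ0 x)) (cutoff_le_one _)
  linarith

/-- The truncated inequality can be tested with functions which do not vanish on the boundary. -/
theorem integral_cutoff_sq_mul_inner_le (hΩo : IsOpen Ω) (hΩb : Bornology.IsBounded Ω)
    {u N : EuclideanSpace ℝ (Fin n) → ℝ} {G : EuclideanSpace ℝ (Fin n) → EuclideanSpace ℝ (Fin n)}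
    {lam : ℝ} (hlam : 0 < lam)
    {φ : ℕ → EuclideanSpace ℝ (Fin n) → ℝ} (hφ : ∀ k, IsTestFunction Ω (φ k))
    (hφu : ∀ᵐ x ∂(volume.restrict Ω), Tendsto (fun k => φ k x) atTop (𝓝 (u x)))
    (hu : ∀ᵐ x ∂(volume.restrict Ω), 0 < u x)
    (hum : AEStronglyMeasurable u (volume.restrict Ω))
    (hG : MemLp G 2 (volume.restrict Ω))
    (hφG : Tendsto (fun k => eLpNorm (fun x => gradient (φ k) x - G x) 2 (volume.restrict Ω))
      atTop (𝓝 0))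
    (hN : IntegrableOn N Ω) (hN0 : ∀ᵐ x ∂(volume.restrict Ω), 0 ≤ N x)
    (hle : ∀ ζ : EuclideanSpace ℝ (Fin n) → ℝ, IsTestFunction Ω ζ → (∀ x, 0 ≤ ζ x) →
      ∫ x in Ω, cutoff (u x) * inner ℝ (G x) (gradient ζ x) ≤ ∫ x in Ω, (lam + N x) * ζ x)
    {ψ : EuclideanSpace ℝ (Fin n) → ℝ} (hψ : ContDiff ℝ ∞ ψ) (hψ0 : ∀ x, 0 ≤ ψ x) :
    ∫ x in Ω, cutoff (u x) ^ 2 * inner ℝ (gradient ψ x) (G x) ≤ ∫ x in Ω, (lam + N x) * ψ x := by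
  have hfin : IsFiniteMeasure (volume.restrict Ω) := ⟨by simpa using hΩb.measure_lt_top⟩
  obtain ⟨M, hM, -⟩ := exists_bound_of_contDiff hΩb hψ
  have hMae : ∀ᵐ x ∂(volume.restrict Ω), ‖ψ x‖ ≤ M :=
    (ae_restrict_iff' hΩo.measurableSet).2 (Eventually.of_forall hM)
  have hFψ : Integrable (fun x => (lam + N x) * ψ x) (volume.restrict Ω) :=
    ((integrable_const lam).add hN).mul_bdd hψ.continuous.aestronglyMeasurable hMae
  -- The first truncation is absorbed in the field; a second one, through φ_k, localises ψ inside Ω.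
  -- Their product in the limit is the square.
  have hW : MemLp (fun x => cutoff (u x) • G x) 2 (volume.restrict Ω) := by
    refine hG.of_le (((contDiff_cutoff (m := 0)).continuous.comp_aestronglyMeasurable hum).smul hG.1)
      (Eventually.of_forall fun x => ?_)
    rw [norm_smul]
    exact mul_le_of_le_one_left (norm_nonneg _) (abs_cutoff_le_one _)
  have hL := tendsto_integral_inner_gradient_mul_cutoff hΩo hΩb hφ hφu hG hW hφG hψ
  have hpos : 0 ≤ ∫ x in Ω, ψ x * deriv cutoff (u x) * inner ℝ (cutoff (u x) • G x) (G x) := by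
    refine integral_nonneg_of_ae ?_
    filter_upwards [hu] with x hx
    refine mul_nonneg (mul_nonneg (hψ0 x) (deriv_cutoff_nonneg hx.le)) ?_
    rw [real_inner_smul_left]
    exact mul_nonneg (cutoff_nonneg _) real_inner_self_nonneg
  have hlim := le_of_tendsto' hL (b := ∫ x in Ω, (lam + N x) * ψ x) fun k => by
    have h1 := hle _ ((hφ k).mul_cutoff hψ) fun x => mul_nonneg (hψ0 x) (cutoff_nonneg _)
    calc _ = ∫ x in Ω, cutoff (u x) * inner ℝ (G x) (gradient (fun y => ψ y * cutoff (φ k y)) x) := by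
          simp_rw [real_inner_smul_left]
      _ ≤ _ := h1
      _ ≤ _ := by
        refine integral_mono_of_nonneg ?_ hFψ ?_
        · filter_upwards [hN0] with x hx
          exact mul_nonneg (add_nonneg hlam.le hx) (mul_nonneg (hψ0 x) (cutoff_nonneg _))
        · filter_upwards [hN0] with x hx
          exact mul_le_mul_of_nonneg_left (mul_le_of_le_one_right (hψ0 x) (cutoff_le_one _))
            (add_nonneg hlam.le hx)
  have hrew : ∫ x in Ω, cutoff (u x) ^ 2 * inner ℝ (gradient ψ x) (G x)
      = ∫ x in Ω, cutoff (u x) * inner ℝ (cutoff (u x) • G x) (gradient ψ x) := by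
    refine integral_congr_ae (Eventually.of_forall fun x => ?_)
    simp only [real_inner_smul_left, real_inner_comm (G x)]
    ring
  linarith

end WeakFormulation

/-! ### The regularised fundamental solution as a test function. -/

section FundamentalSolution

variable {n : ℕ} {Ω : Set (EuclideanSpace ℝ (Fin n))}

/-- The square of the regularised distance to `x`. -/
noncomputable def regSq (ε : ℝ) (x y : EuclideanSpace ℝ (Fin n)) : ℝ := ‖y - x‖ ^ 2 + ε ^ 2

theorem regSq_pos {ε : ℝ} (hε : 0 < ε) (x y : EuclideanSpace ℝ (Fin n)) : 0 < regSq ε x y := by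
  unfold regSq; positivity

theorem contDiff_regSq_rpow {ε : ℝ} (hε : 0 < ε) (x : EuclideanSpace ℝ (Fin n)) (c : ℝ) :
    ContDiff ℝ ∞ fun y => regSq ε x y ^ c := by
  refine ContDiff.rpow_const_of_ne ?_ fun y => (regSq_pos hε x y).ne'
  exact ((contDiff_id.sub contDiff_const).norm_sq ℝ).add contDiff_const

theorem fderiv_regSq_rpow {ε : ℝ} (hε : 0 < ε) (x y v : EuclideanSpace ℝ (Fin n)) (c : ℝ) :
    fderiv ℝ (fun y => regSq ε x y ^ c) y v = 2 * c * regSq ε x y ^ (c - 1) * inner ℝ (y - x) v := by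
  have h1 : HasFDerivAt (fun y => regSq ε x y) (2 • innerSL ℝ (y - x)) y := by
    have := ((hasFDerivAt_id y).sub_const x).norm_sq.add_const (ε ^ 2)
    exact this.congr_fderiv (by ext; simp)
  have h2 := h1.rpow_const (p := c) (Or.inl (regSq_pos hε x y).ne')
  rw [h2.fderiv]
  simp [inner_sub_left]
  ring

/-- Testing with the regularised fundamental solution. -/
theorem integral_inner_gradient_regSq {ε : ℝ} (hε : 0 < ε) (x : EuclideanSpace ℝ (Fin n))
    {w : EuclideanSpace ℝ (Fin n) → ℝ} (hw : ContDiff ℝ ∞ w) (hwc : HasCompactSupport w) :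
    ∫ y, inner ℝ (gradient (fun y => regSq ε x y ^ ((2 - n : ℝ) / 2)) y) (gradient w y)
      = (n - 2) * n * ε ^ 2 * ∫ y, regSq ε x y ^ (-(n : ℝ) / 2 - 1) * w y := by
  let b := EuclideanSpace.basisFun (Fin n) ℝ
  -- Components of the gradient of the regularised fundamental solution, to be integrated by parts
  -- one coordinate at a time.
  let X : Fin n → EuclideanSpace ℝ (Fin n) → ℝ := fun i y =>
    (2 - n : ℝ) * regSq ε x y ^ (-(n : ℝ) / 2) * inner ℝ (y - x) (b i)
  have hXs : ∀ i, ContDiff ℝ ∞ (X i) := fun i =>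
    (contDiff_const.mul (contDiff_regSq_rpow hε x _)).mul
      ((contDiff_id.sub contDiff_const).inner ℝ contDiff_const)
  have hgrad : ∀ y i, inner ℝ (gradient (fun y => regSq ε x y ^ ((2 - n : ℝ) / 2)) y) (b i) = X i y := by
    intro y i
    rw [inner_gradient_left, fderiv_regSq_rpow hε]
    have : (2 - n : ℝ) / 2 - 1 = -(n : ℝ) / 2 := by ring
    rw [this]
    simp only [X]; ring
  have hXd : ∀ i y, fderiv ℝ (X i) y (b i) = (2 - n : ℝ) * (regSq ε x y ^ (-(n : ℝ) / 2)
      - n * regSq ε x y ^ (-(n : ℝ) / 2 - 1) * inner ℝ (y - x) (b i) ^ 2) := by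
    intro i y
    have h1 : HasFDerivAt (fun y => regSq ε x y ^ (-(n : ℝ) / 2)) _ y :=
      ((contDiff_regSq_rpow hε x _).differentiable (by simp) y).hasFDerivAt
    have h2 : HasFDerivAt (fun y => inner ℝ (y - x) (b i)) (innerSL ℝ (b i)) y := by
      have h := (innerSL ℝ (b i)).hasFDerivAt (x := y - x)
      have h' := h.comp y ((hasFDerivAt_id y).sub_const x)
      refine (h'.congr_of_eventuallyEq (Eventually.of_forall fun z => ?_)).congr_fderiv ?_
      · simp [real_inner_comm]
      · ext; simp
    have h3 : fderiv ℝ (X i) y = _ := ((h1.const_mul (2 - n : ℝ)).mul h2).fderiv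
    have hb : inner ℝ (b i) (b i) = (1 : ℝ) := by
      rw [real_inner_self_eq_norm_sq, b.norm_eq_one]; norm_num
    rw [h3]
    simp only [add_apply, smul_apply, innerSL_apply_apply,
      hb, fderiv_regSq_rpow hε, smul_eq_mul]
    ring
  -- As |y-x|² is the regularised square minus ε², the leading terms cancel and only the ε² term
  -- survives.
  have hdiv : ∀ y, ∑ i, fderiv ℝ (X i) y (b i)
      = -((n - 2) * n * ε ^ 2 * regSq ε x y ^ (-(n : ℝ) / 2 - 1)) := by
    intro y
    have hs : ∑ i, inner ℝ (y - x) (b i) ^ 2 = ‖y - x‖ ^ 2 := by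
      have h := b.sum_inner_mul_inner (y - x) (y - x)
      rw [real_inner_self_eq_norm_sq] at h
      rw [← h]
      refine Finset.sum_congr rfl fun i _ => ?_
      rw [real_inner_comm (y - x) (b i)]; ring
    have hr : regSq ε x y ^ (-(n : ℝ) / 2) = regSq ε x y ^ (-(n : ℝ) / 2 - 1) * regSq ε x y := by
      rw [Real.rpow_sub_one (regSq_pos hε x y).ne', div_mul_cancel₀ _ (regSq_pos hε x y).ne']
    simp_rw [hXd]
    rw [← Finset.mul_sum, Finset.sum_sub_distrib, ← Finset.mul_sum, hs, Finset.sum_const,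
      Finset.card_univ, Fintype.card_fin, nsmul_eq_mul, hr]
    unfold regSq
    ring
  have hwi : ∀ i, Continuous fun y => fderiv ℝ w y (b i) := fun i =>
    (hw.continuous_fderiv (by simp)).clm_apply continuous_const
  have hwic : ∀ i, HasCompactSupport fun y => fderiv ℝ w y (b i) := fun i =>
    hwc.fderiv_apply (𝕜 := ℝ) (b i)
  have hXi : ∀ i, Continuous fun y => fderiv ℝ (X i) y (b i) := fun i =>
    ((hXs i).continuous_fderiv (by simp)).clm_apply continuous_const
  have i1 : ∀ i, Integrable fun y => X i y * fderiv ℝ w y (b i) := fun i =>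
    ((hXs i).continuous.mul (hwi i)).integrable_of_hasCompactSupport (hwic i).mul_left
  have i2 : ∀ i, Integrable fun y => fderiv ℝ (X i) y (b i) * w y := fun i =>
    ((hXi i).mul hw.continuous).integrable_of_hasCompactSupport hwc.mul_left
  have i3 : ∀ i, Integrable fun y => X i y * w y := fun i =>
    ((hXs i).continuous.mul hw.continuous).integrable_of_hasCompactSupport hwc.mul_left
  have hparts : ∀ i, ∫ y, X i y * fderiv ℝ w y (b i) = - ∫ y, fderiv ℝ (X i) y (b i) * w y :=
    fun i => integral_mul_fderiv_eq_neg_fderiv_mul_of_integrable (i2 i) (i1 i) (i3 i)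
      (fun y _ => (hXs i).differentiable (by simp) y) (fun y _ => hw.differentiable (by simp) y)
  calc _ = ∫ y, ∑ i, X i y * fderiv ℝ w y (b i) := by
        refine integral_congr_ae (Eventually.of_forall fun y => ?_)
        simp only
        rw [← b.sum_inner_mul_inner]
        refine Finset.sum_congr rfl fun i _ => ?_
        rw [hgrad, inner_gradient_right]; simp
    _ = - ∫ y, ∑ i, fderiv ℝ (X i) y (b i) * w y := by
        rw [integral_finsetSum _ fun i _ => i1 i, integral_finsetSum _ fun i _ => i2 i,
          ← Finset.sum_neg_distrib]
        exact Finset.sum_congr rfl fun i _ => hparts i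
    _ = _ := by
        rw [← integral_const_mul, ← integral_neg]
        refine integral_congr_ae (Eventually.of_forall fun y => ?_)
        simp only
        rw [← Finset.sum_mul, hdiv]; ring

/-- Formally `cutoff u ^ 2` times G is the gradient of `cutoffPrim u`, extended by zero outside Ω.
The identity holds for the smooth compactly supported functions `cutoffPrim (φ k)`, and passes to
the limit because `cutoffPrim` is 1-Lipschitz. -/
theorem integral_cutoff_sq_mul_inner_regSq (hΩo : IsOpen Ω) (hΩb : Bornology.IsBounded Ω)
    {u : EuclideanSpace ℝ (Fin n) → ℝ} {G : EuclideanSpace ℝ (Fin n) → EuclideanSpace ℝ (Fin n)}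
    {φ : ℕ → EuclideanSpace ℝ (Fin n) → ℝ} (hφ : ∀ k, IsTestFunction Ω (φ k))
    (hφu : ∀ᵐ x ∂(volume.restrict Ω), Tendsto (fun k => φ k x) atTop (𝓝 (u x)))
    (hum : MemLp u 2 (volume.restrict Ω))
    (hφL : Tendsto (fun k => eLpNorm (fun x => φ k x - u x) 2 (volume.restrict Ω)) atTop (𝓝 0))
    (hG : MemLp G 2 (volume.restrict Ω))
    (hφG : Tendsto (fun k => eLpNorm (fun x => gradient (φ k) x - G x) 2 (volume.restrict Ω))
      atTop (𝓝 0)) {ε : ℝ} (hε : 0 < ε) (x : EuclideanSpace ℝ (Fin n)) :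
    ∫ y in Ω, cutoff (u y) ^ 2 *
        inner ℝ (gradient (fun y => regSq ε x y ^ ((2 - n : ℝ) / 2)) y) (G y)
      = (n - 2) * n * ε ^ 2 *
        ∫ y in Ω, regSq ε x y ^ (-(n : ℝ) / 2 - 1) * cutoffPrim (u y) := by
  have hfin : IsFiniteMeasure (volume.restrict Ω) := ⟨by simpa using hΩb.measure_lt_top⟩
  have hψ := contDiff_regSq_rpow hε x ((2 - n : ℝ) / 2)
  have hg := contDiff_regSq_rpow hε x (-(n : ℝ) / 2 - 1)
  have hc : Continuous cutoff := (contDiff_cutoff (m := 0)).continuous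
  have hP : Continuous cutoffPrim := (contDiff_cutoffPrim (m := 0)).continuous
  have h1 := tendsto_integral_mul_inner (ν := volume.restrict Ω) (M := 1)
    (m := fun k y => cutoff (φ k y) ^ 2) (m' := fun y => cutoff (u y) ^ 2)
    (fun k => ((hc.comp (hφ k).1.continuous).pow 2).aestronglyMeasurable)
    (fun k => Eventually.of_forall fun y => by
      rw [abs_pow]; exact pow_le_one₀ (abs_nonneg _) (abs_cutoff_le_one _))
    (by
      filter_upwards [hφu] with y hy
      exact ((hc.tendsto _).comp hy).pow 2)
    (memLp_gradient_of_contDiff hΩo hΩb hψ) hG (fun k => (hφ k).memLp_gradient) hφG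
  have hgL : MemLp (fun y => regSq ε x y ^ (-(n : ℝ) / 2 - 1)) 2 (volume.restrict Ω) := by
    obtain ⟨M, hM, -⟩ := exists_bound_of_contDiff hΩb hg
    exact MemLp.of_bound hg.continuous.aestronglyMeasurable M
      ((ae_restrict_iff' hΩo.measurableSet).2 (Eventually.of_forall hM))
  have hP0 : ∀ t, |cutoffPrim t| ≤ |t| := fun t => by
    simpa [cutoffPrim_zero] using abs_cutoffPrim_sub_le t 0
  have hPL : ∀ {v : EuclideanSpace ℝ (Fin n) → ℝ}, MemLp v 2 (volume.restrict Ω) →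
      MemLp (fun y => cutoffPrim (v y)) 2 (volume.restrict Ω) := fun hv =>
    hv.of_le (hP.comp_aestronglyMeasurable hv.1) (Eventually.of_forall fun y => hP0 _)
  -- The same limit lemma with scalar fields and coefficient 1 is just continuity of the L² pairing.
  have h2 := tendsto_integral_mul_inner (ν := volume.restrict Ω) (M := 1) (F := ℝ)
    (m := fun _ _ => 1) (m' := fun _ => 1) (fun k => aestronglyMeasurable_const)
    (fun k => Eventually.of_forall fun y => by simp)
    (Eventually.of_forall fun y => tendsto_const_nhds) hgL (hPL hum)
    (Bk := fun k y => cutoffPrim (φ k y))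
    (fun k => hPL (((hφ k).1.continuous.memLp_of_hasCompactSupport (hφ k).2.1).restrict Ω))
    (tendsto_of_tendsto_of_tendsto_of_le_of_le tendsto_const_nhds hφL (fun k => zero_le)
      fun k => eLpNorm_mono fun y => abs_cutoffPrim_sub_le _ _)
  have h3 := h2.const_mul ((n - 2) * n * ε ^ 2 : ℝ)
  simp only [one_mul, Real.inner_apply] at h3
  refine tendsto_nhds_unique (h1.congr fun k => ?_) h3
  have hw : ContDiff ℝ ∞ fun y => cutoffPrim (φ k y) := contDiff_cutoffPrim.comp (hφ k).1
  have hwc : HasCompactSupport fun y => cutoffPrim (φ k y) := (hφ k).2.1.comp_left cutoffPrim_zero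
  have hsupp : ∀ y, y ∉ Ω → y ∉ tsupport (φ k) := fun y hy h => hy ((hφ k).2.2 h)
  have hmain := integral_inner_gradient_regSq hε x hw hwc
  have h4 : ∀ y, fderiv ℝ (fun y => cutoffPrim (φ k y)) y = (cutoff (φ k y) ^ 2) • fderiv ℝ (φ k) y :=
    fun y => ((hasDerivAt_cutoffPrim (φ k y)).comp_hasFDerivAt y
      ((hφ k).1.differentiable (by simp) y).hasFDerivAt).fderiv
  have e1 := setIntegral_eq_integral_of_forall_compl_eq_zero (μ := volume) (s := Ω)
    (f := fun y => inner ℝ (gradient (fun y => regSq ε x y ^ ((2 - n : ℝ) / 2)) y)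
      (gradient (fun y => cutoffPrim (φ k y)) y)) fun y hy => by
        rw [inner_gradient_right, h4, image_eq_zero_of_notMem_tsupport (hsupp y hy)]
        simp [cutoff_zero]
  have e2 := setIntegral_eq_integral_of_forall_compl_eq_zero (μ := volume) (s := Ω)
    (f := fun y => regSq ε x y ^ (-(n : ℝ) / 2 - 1) * cutoffPrim (φ k y)) fun y hy => by
        rw [image_eq_zero_of_notMem_tsupport (hsupp y hy), cutoffPrim_zero, mul_zero]
  rw [e2, ← hmain, ← e1]
  refine integral_congr_ae (Eventually.of_forall fun y => ?_)
  simp only [inner_gradient_right, h4]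
  simp

end FundamentalSolution

/-! ### Pointwise bound from averages over shrinking balls. -/

section Pointwise

variable {n : ℕ} {Ω : Set (EuclideanSpace ℝ (Fin n))}

/-- On the ball of radius ε about x the regularised square is at most 2ε², so ε² `regSq`^{-n/2-1} is
at least 2^{-n/2-1} ε^{-n} there. As w ≥ 0, it dominates a fixed multiple of the average over that
ball. -/
theorem average_le_of_regSq_le (hn : 2 < n) (hΩo : IsOpen Ω) {w g : EuclideanSpace ℝ (Fin n) → ℝ}
    (hw : IntegrableOn w Ω) (hw0 : ∀ᵐ x ∂(volume.restrict Ω), 0 ≤ w x) {ε : ℝ} (hε : 0 < ε)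
    (hΩb : Bornology.IsBounded Ω) (x : EuclideanSpace ℝ (Fin n))
    (hle : (n - 2) * n * ε ^ 2 * (∫ y in Ω, regSq ε x y ^ (-(n : ℝ) / 2 - 1) * w y)
      ≤ ∫ y in Ω, g y * regSq ε x y ^ ((2 - n : ℝ) / 2)) :
    ((n - 2) * n * 2 ^ (-(n : ℝ) / 2 - 1) *
      (volume.real (Metric.ball (0 : EuclideanSpace ℝ (Fin n)) 1))) *
        (⨍ y in Metric.closedBall x ε, Ω.indicator w y)
      ≤ ∫ y in Ω, g y * regSq ε x y ^ ((2 - n : ℝ) / 2) := by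
  have hn' : (2 : ℝ) < n := by exact_mod_cast hn
  set V := volume.real (Metric.ball (0 : EuclideanSpace ℝ (Fin n)) 1) with hV
  have hVp : 0 < V := 
    ENNReal.toReal_pos (Metric.measure_ball_pos _ _ one_pos).ne' measure_ball_lt_top.ne
  have hwi : Integrable (Ω.indicator w) := hw.integrable_indicator hΩo.measurableSet
  have hs := contDiff_regSq_rpow hε x (-(n : ℝ) / 2 - 1)
  obtain ⟨M, hM, -⟩ := exists_bound_of_contDiff hΩb hs
  have hint : IntegrableOn (fun y => regSq ε x y ^ (-(n : ℝ) / 2 - 1) * w y) Ω :=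
    Integrable.bdd_mul hw hs.continuous.aestronglyMeasurable
      ((ae_restrict_iff' hΩo.measurableSet).2 (Eventually.of_forall hM))
  have hind : ∀ᵐ y, 0 ≤ Ω.indicator w y := by
    have := (ae_restrict_iff' hΩo.measurableSet).1 hw0
    filter_upwards [this] with y hy
    exact Set.indicator_apply_nonneg hy
  have hlow : (2 * ε ^ 2) ^ (-(n : ℝ) / 2 - 1) * ∫ y in Metric.closedBall x ε, Ω.indicator w y
      ≤ ∫ y in Ω, regSq ε x y ^ (-(n : ℝ) / 2 - 1) * w y := by
    rw [← integral_const_mul, ← integral_indicator Metric.isClosed_closedBall.measurableSet,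
      ← integral_indicator hΩo.measurableSet]
    refine integral_mono_of_nonneg ?_ (hint.integrable_indicator hΩo.measurableSet) ?_
    · filter_upwards [hind] with y hy
      by_cases hyb : y ∈ Metric.closedBall x ε
      · rw [Set.indicator_of_mem hyb]; exact mul_nonneg (by positivity) hy
      · rw [Set.indicator_of_notMem hyb]; rfl
    · filter_upwards [hind] with y hy
      by_cases hyΩ : y ∈ Ω
      · rw [Set.indicator_of_mem hyΩ] at hy
        rw [Set.indicator_of_mem hyΩ]
        by_cases hyb : y ∈ Metric.closedBall x ε
        · rw [Set.indicator_of_mem hyb, Set.indicator_of_mem hyΩ]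
          refine mul_le_mul_of_nonneg_right ?_ hy
          refine Real.rpow_le_rpow_of_nonpos (regSq_pos hε x y) ?_ (by linarith)
          have : ‖y - x‖ ≤ ε := by simpa [dist_eq_norm] using hyb
          unfold regSq
          nlinarith [norm_nonneg (y - x)]
        · rw [Set.indicator_of_notMem hyb]
          exact mul_nonneg (Real.rpow_nonneg (regSq_pos hε x y).le _) hy
      · rw [Set.indicator_of_notMem hyΩ]
        by_cases hyb : y ∈ Metric.closedBall x ε
        · rw [Set.indicator_of_mem hyb, Set.indicator_of_notMem hyΩ, mul_zero]
        · rw [Set.indicator_of_notMem hyb]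
  have hvol : volume.real (Metric.closedBall x ε) = ε ^ n * V := by
    rw [Measure.addHaar_real_closedBall volume x hε.le, finrank_euclideanSpace_fin]
  have hc : (ε ^ 2) * (2 * ε ^ 2) ^ (-(n : ℝ) / 2 - 1) * ε ^ n = 2 ^ (-(n : ℝ) / 2 - 1) := by
    rw [Real.mul_rpow (by norm_num) (by positivity), ← Real.rpow_natCast ε 2,
      ← Real.rpow_natCast ε n, ← Real.rpow_mul hε.le]
    have : ε ^ ((2 : ℕ) : ℝ) * ε ^ (((2 : ℕ) : ℝ) * (-(n : ℝ) / 2 - 1)) * ε ^ (n : ℝ) = 1 := by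
      rw [← Real.rpow_add hε, ← Real.rpow_add hε]
      convert Real.rpow_zero ε using 2
      push_cast; ring
    linear_combination (2 : ℝ) ^ (-(n : ℝ) / 2 - 1) * this
  refine le_trans (le_of_eq ?_) ((mul_le_mul_of_nonneg_left hlow (by
    have : 0 < (n : ℝ) - 2 := by linarith
    positivity)).trans hle)
  have havg : (∫ y in Metric.closedBall x ε, Ω.indicator w y)
      = ε ^ n * V * ⨍ y in Metric.closedBall x ε, Ω.indicator w y := by
    rw [← hvol]
    have := measure_smul_setAverage (μ := volume) (Ω.indicator w)
      (s := Metric.closedBall x ε) measure_closedBall_lt_top.ne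
    rw [← this, smul_eq_mul]
  rw [havg, ← hc]
  ring

/-- Pointwise bound by the Riesz potential of order two. -/
theorem exists_ae_ofReal_le_rieszPot (hn : 2 < n) (hΩo : IsOpen Ω) (hΩb : Bornology.IsBounded Ω)
    {w g : EuclideanSpace ℝ (Fin n) → ℝ} (hw : IntegrableOn w Ω)
    (hw0 : ∀ᵐ x ∂(volume.restrict Ω), 0 ≤ w x) (hg : IntegrableOn g Ω)
    (hg0 : ∀ᵐ x ∂(volume.restrict Ω), 0 ≤ g x)
    (hle : ∀ ε > 0, ∀ x, (n - 2) * n * ε ^ 2 * (∫ y in Ω, regSq ε x y ^ (-(n : ℝ) / 2 - 1) * w y)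
      ≤ ∫ y in Ω, g y * regSq ε x y ^ ((2 - n : ℝ) / 2)) :
    ∃ C : ENNReal, C ≠ ⊤ ∧ ∀ᵐ x ∂(volume.restrict Ω), ENNReal.ofReal (w x)
      ≤ C * ∫⁻ y in Ω, ENNReal.ofReal (g y) * rieszKernel (n - 2) (x - y) := by
  have hn' : (2 : ℝ) < n := by exact_mod_cast hn
  set c := ((n : ℝ) - 2) * n * 2 ^ (-(n : ℝ) / 2 - 1) *
      (volume.real (Metric.ball (0 : EuclideanSpace ℝ (Fin n)) 1)) with hc
  have hcp : 0 < c := by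
    have h1 : 0 < volume.real (Metric.ball (0 : EuclideanSpace ℝ (Fin n)) 1) :=
      
    ENNReal.toReal_pos (Metric.measure_ball_pos _ _ one_pos).ne' measure_ball_lt_top.ne
    have h2 : 0 < (n : ℝ) - 2 := by linarith
    positivity
  have : Nonempty (Fin n) := ⟨⟨0, by omega⟩⟩
  have hbound : ∀ ε > 0, ∀ x, ENNReal.ofReal (c * ⨍ y in Metric.closedBall x ε, Ω.indicator w y)
      ≤ ∫⁻ y in Ω, ENNReal.ofReal (g y) * rieszKernel (n - 2) (x - y) := by
    intro ε hε x
    have hs := contDiff_regSq_rpow hε x ((2 - n : ℝ) / 2)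
    obtain ⟨M, hM, -⟩ := exists_bound_of_contDiff hΩb hs
    have hint : IntegrableOn (fun y => g y * regSq ε x y ^ ((2 - n : ℝ) / 2)) Ω :=
      Integrable.mul_bdd hg hs.continuous.aestronglyMeasurable
        ((ae_restrict_iff' hΩo.measurableSet).2 (Eventually.of_forall hM))
    refine (ENNReal.ofReal_le_ofReal (average_le_of_regSq_le hn hΩo hw hw0 hε hΩb x
      (hle ε hε x))).trans ?_
    rw [ofReal_integral_eq_lintegral_ofReal hint]
    · refine lintegral_mono_ae ?_
      -- At y = x the real power of 0 takes the value 0 instead of ∞, so the comparison of kernels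
      -- would fail at that single point.
      have hne : ∀ᵐ y ∂(volume.restrict Ω), y ≠ x :=
        ae_restrict_of_ae (by rw [ae_iff]; simp)
      filter_upwards [hg0, hne] with y hy hyx
      rw [ENNReal.ofReal_mul hy, rieszKernel]
      gcongr
      have h1 : 0 < ‖x - y‖ := norm_pos_iff.2 (sub_ne_zero.2 hyx.symm)
      have h2 : ‖x - y‖ ^ (-((n : ℝ) - 2)) = (‖x - y‖ ^ 2) ^ ((2 - n : ℝ) / 2) := by
        rw [← Real.rpow_natCast, ← Real.rpow_mul h1.le]
        congr 1; push_cast; ring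
      rw [h2]
      refine Real.rpow_le_rpow_of_nonpos (by positivity) ?_ (by linarith)
      unfold regSq
      rw [norm_sub_rev]
      nlinarith [sq_nonneg ε]
    · filter_upwards [hg0] with y hy
      exact mul_nonneg hy (Real.rpow_nonneg (regSq_pos hε x y).le _)
  refine ⟨(ENNReal.ofReal c)⁻¹, by simpa using hcp, ?_⟩
  have hwi : Integrable (Ω.indicator w) := hw.integrable_indicator hΩo.measurableSet
  -- Since the bound on averages is uniform in ε, Lebesgue differentiation turns it into a pointwise
  -- bound almost everywhere.
  have hLeb := IsUnifLocDoublingMeasure.ae_tendsto_average (μ := volume) hwi.locallyIntegrable 1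
  have hLeb' := ae_restrict_of_ae (s := Ω) hLeb
  filter_upwards [hLeb', ae_restrict_mem hΩo.measurableSet] with x hx hxΩ
  have ht := hx (ι := ℝ) (l := 𝓝[>] 0) (fun _ => x) id tendsto_id (by
    filter_upwards [self_mem_nhdsWithin] with ε hε
    simpa using le_of_lt hε)
  rw [Set.indicator_of_mem hxΩ] at ht
  have ht2 := (ENNReal.continuous_ofReal.tendsto _).comp (ht.const_mul c)
  have h3 : ENNReal.ofReal (c * w x)
      ≤ ∫⁻ y in Ω, ENNReal.ofReal (g y) * rieszKernel (n - 2) (x - y) := by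
    refine le_of_tendsto ht2 ?_
    filter_upwards [self_mem_nhdsWithin] with ε hε
    exact hbound ε hε x
  rw [ENNReal.ofReal_mul hcp.le] at h3
  rw [mul_comm, ← div_eq_mul_inv, ENNReal.le_div_iff_mul_le (Or.inl (by simpa using hcp))
    (Or.inl ENNReal.ofReal_ne_top), mul_comm]
  exact h3

end Pointwise

/-! ### Sobolev integrability of the solution. -/

section Regularity

open Module

variable {n : ℕ} {Ω : Set (EuclideanSpace ℝ (Fin n))}

/-- The Sobolev embedding `H¹₀(Ω) ⊂ L^{2n/(n-2)}(Ω)`. -/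
theorem memLp_sobolev (hn : 2 < n)
    {u : EuclideanSpace ℝ (Fin n) → ℝ} {G : EuclideanSpace ℝ (Fin n) → EuclideanSpace ℝ (Fin n)}
    {φ : ℕ → EuclideanSpace ℝ (Fin n) → ℝ} (hφ : ∀ k, IsTestFunction Ω (φ k))
    (hφu : ∀ᵐ x ∂(volume.restrict Ω), Tendsto (fun k => φ k x) atTop (𝓝 (u x)))
    (hum : AEStronglyMeasurable u (volume.restrict Ω))
    (hG : MemLp G 2 (volume.restrict Ω))
    (hφG : Tendsto (fun k => eLpNorm (fun x => gradient (φ k) x - G x) 2 (volume.restrict Ω))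
      atTop (𝓝 0)) : MemLp u (ENNReal.ofReal (2 * n / (n - 2))) (volume.restrict Ω) := by
  have hn' : (2 : ℝ) < n := by exact_mod_cast hn
  have hn2 : (0 : ℝ) < n - 2 := by linarith
  set p' : NNReal := Real.toNNReal (2 * n / (n - 2)) with hp'
  have hp'c : (p' : ℝ) = 2 * n / (n - 2) := Real.coe_toNNReal _ (by positivity)
  set C : ENNReal := ((SNormLESNormFDerivOfEqConst ℝ
    (volume : Measure (EuclideanSpace ℝ (Fin n))) ((2 : NNReal) : ℝ) : NNReal) : ENNReal) with hC
  have hgrad : ∀ k, eLpNorm (φ k) p' (volume.restrict Ω)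
      ≤ C * eLpNorm (gradient (φ k)) 2 (volume.restrict Ω) := by
    intro k
    have h1 := eLpNorm_le_eLpNorm_fderiv_of_eq (F := ℝ) (p := 2) (p' := p')
      (volume : Measure (EuclideanSpace ℝ (Fin n)))
      ((hφ k).1.of_le (by simp)) (hφ k).2.1 (by norm_num) (by rw [finrank_euclideanSpace_fin]; omega)
      (by rw [hp'c, finrank_euclideanSpace_fin]; push_cast; field_simp)
    have h2 : eLpNorm (fderiv ℝ (φ k)) 2 volume = eLpNorm (gradient (φ k)) 2 volume :=
      eLpNorm_congr_norm_ae (Eventually.of_forall fun x => by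
        rw [gradient, LinearIsometryEquiv.norm_map])
    have h3 : eLpNorm (gradient (φ k)) 2 (volume.restrict Ω) = eLpNorm (gradient (φ k)) 2 volume := by
      refine eLpNorm_restrict_eq_of_support_subset fun x hx => ?_
      refine (hφ k).2.2 ((support_fderiv_subset ℝ) ?_)
      intro h0
      exact hx (by rw [gradient, h0, map_zero])
    rw [h3, ← h2]
    exact (eLpNorm_mono_measure _ Measure.restrict_le_self).trans h1
  refine ⟨hum, ?_⟩
  -- Fatou: the Sobolev inequality is needed only for test functions, whose gradients stay bounded
  -- in L².
  have hlim := Lp.eLpNorm_lim_le_liminf_eLpNorm (p := p')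
    (fun k => (hφ k).1.continuous.aestronglyMeasurable) u hφu
  refine hlim.trans_lt ?_
  have hev : ∀ᶠ k in atTop, eLpNorm (φ k) p' (volume.restrict Ω)
      ≤ C * (1 + eLpNorm G 2 (volume.restrict Ω)) := by
    filter_upwards [hφG.eventually (gt_mem_nhds zero_lt_one)] with k hk
    refine (hgrad k).trans ?_
    gcongr
    have h4 : gradient (φ k) = (fun x => gradient (φ k) x - G x) + G := by ext x : 1; simp
    rw [h4]
    refine (eLpNorm_add_le ((hφ k).memLp_gradient.1.sub hG.1) hG.1 (by norm_num)).trans ?_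
    exact add_le_add hk.le le_rfl
  refine (liminf_le_liminf hev).trans_lt ?_
  rw [liminf_const]
  have := hG.2.ne
  exact lt_top_iff_ne_top.2 (by finiteness)

theorem lrNorm_ne_top_iff_memLp {u : EuclideanSpace ℝ (Fin n) → ℝ}
    {U : EuclideanSpace ℝ (Fin n) → ENNReal} (hu : ∀ᵐ x ∂(volume.restrict Ω), 0 < u x)
    (hum : AEStronglyMeasurable u (volume.restrict Ω))
    (hU0 : ∀ x ∉ Ω, U x = 0) (hUu : ∀ᵐ x ∂(volume.restrict Ω), U x = ENNReal.ofReal (u x))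
    {s : ℝ} (hs : 0 < s) :
    lrNorm s U ≠ ⊤ ↔ MemLp u (ENNReal.ofReal s) (volume.restrict Ω) := by
  have h1 : ∫⁻ x, U x ^ s = ∫⁻ x in Ω, ‖u x‖ₑ ^ s := by
    have hsupp : (Function.support fun x => U x ^ s) ⊆ Ω := fun x hx => by
      by_contra hxΩ
      exact hx (by simp [hU0 x hxΩ, hs])
    rw [← setLIntegral_eq_of_support_subset hsupp]
    refine lintegral_congr_ae ?_
    filter_upwards [hu, hUu] with x hx hx2
    rw [hx2, Real.enorm_eq_ofReal hx.le]
  rw [lrNorm_ne_top_iff hs, h1, MemLp, and_iff_right hum,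
    eLpNorm_lt_top_iff_lintegral_rpow_enorm_lt_top (by simpa using hs) ENNReal.ofReal_ne_top,
    ENNReal.toReal_ofReal hs.le, lt_top_iff_ne_top]

end Regularity

/-! ### The Choquard nonlinearity as a Riesz potential. -/

section ChoquardEquation

open Module

variable {n : ℕ} {Ω : Set (EuclideanSpace ℝ (Fin n))}

theorem critExp_mul (hn : 2 < n) (mu : ℝ) : critExp n mu * ((n : ℝ) - 2) = 2 * n - mu := by
  have hn' : (2 : ℝ) < n := by exact_mod_cast hn
  rw [critExp, div_mul_cancel₀]
  linarith

theorem one_lt_critExp (hn : 2 < n) {mu : ℝ} (hmu : mu < n) : 1 < critExp n mu := by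
  have hn' : (2 : ℝ) < n := by exact_mod_cast hn
  rw [critExp, lt_div_iff₀ (by linarith)]
  linarith

/-- Integrability of the Choquard nonlinearity, by the Hardy–Littlewood–Sobolev inequality. -/
theorem lintegral_choquard_ne_top (hn : 2 < n) {mu : ℝ} (hmu0 : 0 < mu) (hmu : mu < n)
    (hΩo : IsOpen Ω) (hΩb : Bornology.IsBounded Ω)
    {U : EuclideanSpace ℝ (Fin n) → ENNReal} (hU : Measurable U) (hU0 : ∀ x ∉ Ω, U x = 0)
    (hUs : lrNorm (2 * n / (n - 2)) U ≠ ⊤) :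
    ∫⁻ y, rieszPot mu (fun x => U x ^ critExp n mu) y * U y ^ (critExp n mu - 1) ≠ ⊤ := by
  have hn' : (2 : ℝ) < n := by exact_mod_cast hn
  have hn2 : (0 : ℝ) < n - 2 := by linarith
  set p := critExp n mu with hp
  have hp1 : 1 < p := one_lt_critExp hn hmu
  have hpn : 2 * n - mu = p * ((n : ℝ) - 2) := (critExp_mul hn mu).symm
  -- The critical exponent p is the one for which U^p lies in L^{2n/(2n-μ)}, whose Riesz potential
  -- lies in the dual space L^{2n/μ}.
  have hr : 2 * (n : ℝ) / (n - 2) / p = 2 * n / (2 * n - mu) := by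
    rw [div_div, hpn]; congr 1; ring
  have hmup : 0 < 2 * (n : ℝ) - mu := by linarith
  have hUp : lrNorm (2 * n / (2 * n - mu)) (fun x => U x ^ p) ≠ ⊤ := by
    rw [← hr]; exact lrNorm_rpow_ne_top (by positivity) (by linarith) hUs
  have hUpm : Measurable fun x => U x ^ p := hU.pow_const p
  have hV : lrNorm (2 * n / mu) (rieszPot mu (fun x => U x ^ p)) ≠ ⊤ := by
    refine lrNorm_rieszPot_ne_top (E := EuclideanSpace ℝ (Fin n)) (r := 2 * n / (2 * n - mu))
      ?_ ?_ ?_ (by positivity) ?_ hUpm hUp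
    · rw [finrank_euclideanSpace_fin]; omega
    · rwa [finrank_euclideanSpace_fin]
    · rw [lt_div_iff₀ hmup]; linarith
    · rw [finrank_euclideanSpace_fin, one_div_div, one_div_div]; field_simp; ring
  set I : EuclideanSpace ℝ (Fin n) → ENNReal := Ω.indicator fun _ => 1 with hI
  have hIm : Measurable I := measurable_const.indicator hΩo.measurableSet
  have hr1 : 1 ≤ 2 * (n : ℝ) / (2 * n - mu) := by rw [le_div_iff₀ hmup]; linarith
  -- The factor U^{p-1} is majorised by 1_Ω + U^p, so that the pairing of dual exponents applies
  -- directly.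
  have hW : lrNorm (2 * n / (2 * n - mu)) (fun x => I x + U x ^ p) ≠ ⊤ :=
    ne_top_of_le_ne_top (ENNReal.add_ne_top.2 ⟨lrNorm_indicator_const_ne_top hΩo.measurableSet
      hΩb.measure_lt_top.ne ENNReal.one_ne_top (by linarith), hUp⟩) (lrNorm_add_le hr1 hIm hUpm)
  have hprod := lrNorm_mul_le (p := 1) (q := 2 * n / mu) (r := 2 * n / (2 * n - mu)) one_pos
    (by positivity) (by positivity) (by rw [one_div_div, one_div_div]; field_simp; ring)
    (measurable_rieszPot mu hUpm) (hIm.add hUpm)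
  have hfin := (lrNorm_ne_top_iff one_pos).1
    (ne_top_of_le_ne_top (ENNReal.mul_ne_top hV hW) hprod)
  refine ne_top_of_le_ne_top hfin (lintegral_mono fun y => ?_)
  rw [ENNReal.rpow_one]
  refine mul_le_mul_right ?_ _
  by_cases hy : y ∈ Ω
  · rcases le_total (U y) 1 with h1 | h1
    · refine (ENNReal.rpow_le_one h1 (by linarith)).trans ?_
      simp [hI, hy]
    · exact (ENNReal.rpow_le_rpow_of_exponent_le h1 (by linarith)).trans
        (le_add_of_nonneg_left zero_le)
  · rw [hU0 y hy, ENNReal.zero_rpow_of_pos (by linarith)]; exact zero_le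

/-- The double integral in the weak formulation, in terms of the Riesz potential. -/
theorem integral_integral_choquard_eq (hn : 2 < n) {mu : ℝ} (hmu : mu < n)
    {u : EuclideanSpace ℝ (Fin n) → ℝ} {U : EuclideanSpace ℝ (Fin n) → ENNReal}
    (hu : ∀ᵐ x ∂(volume.restrict Ω), 0 < u x)
    (hum : AEStronglyMeasurable u (volume.restrict Ω)) (hU0 : ∀ x ∉ Ω, U x = 0)
    (hUu : ∀ᵐ x ∂(volume.restrict Ω), U x = ENNReal.ofReal (u x))
    (ψ : EuclideanSpace ℝ (Fin n) → ℝ) :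
    (∫ y in Ω, ∫ x in Ω,
        |u x| ^ critExp n mu * |u y| ^ (critExp n mu - 2) * u y * ψ y / ‖x - y‖ ^ mu)
      = ∫ y in Ω, (rieszPot mu (fun x => U x ^ critExp n mu) y * U y ^ (critExp n mu - 1)).toReal
        * ψ y := by
  set p := critExp n mu with hp
  have hp1 : 1 < p := one_lt_critExp hn hmu
  refine integral_congr_ae ?_
  filter_upwards [hu, hUu] with y hy hy2
  have h1 : ∀ x, |u x| ^ p * |u y| ^ (p - 2) * u y * ψ y / ‖x - y‖ ^ mu
      = (|u x| ^ p * ‖y - x‖ ^ (-mu)) * (u y ^ (p - 1) * ψ y) := by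
    intro x
    have e1 : |u y| ^ (p - 2) * u y = u y ^ (p - 1) := by
      rw [abs_of_pos hy]
      nth_rewrite 2 [← Real.rpow_one (u y)]
      rw [← Real.rpow_add hy]; congr 1; ring
    rw [norm_sub_rev y x, Real.rpow_neg (norm_nonneg _), ← e1]
    field_simp
  simp_rw [h1]
  rw [integral_mul_const, integral_eq_lintegral_of_nonneg_ae]
  · have h2 : ∫⁻ x in Ω, ENNReal.ofReal (|u x| ^ p * ‖y - x‖ ^ (-mu))
        = rieszPot mu (fun x => U x ^ p) y := by
      have hsupp : (Function.support fun x => U x ^ p * rieszKernel mu (y - x)) ⊆ Ω := fun x hx => by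
        by_contra hxΩ
        exact hx (by simp [hU0 x hxΩ, (by linarith : 0 < p)])
      rw [rieszPot, ← setLIntegral_eq_of_support_subset hsupp]
      refine lintegral_congr_ae ?_
      filter_upwards [hu, hUu] with x hx hx2
      rw [hx2, rieszKernel, ENNReal.ofReal_mul (by positivity), abs_of_pos hx,
        ENNReal.ofReal_rpow_of_pos hx]
    rw [h2, hy2, ENNReal.toReal_mul, ENNReal.ofReal_rpow_of_pos hy,
      ENNReal.toReal_ofReal (by positivity)]
    ring
  · exact Eventually.of_forall fun x => by positivity
  · have m1 : AEMeasurable (fun x => |u x| ^ p) (volume.restrict Ω) :=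
      (hum.aemeasurable.abs).pow_const p
    have m2 : Measurable fun x => ‖y - x‖ ^ (-mu) := by fun_prop
    exact (m1.mul m2.aemeasurable).aestronglyMeasurable

end ChoquardEquation

end Choquard

/-! ### Assembly: from the weak solution to the integral inequality. -/

theorem lemma6p2 (n : ℕ) (hn : 2 < n) (Ω : Set (EuclideanSpace ℝ (Fin n)))
    (hΩ_open : IsOpen Ω) (hΩ_conn : IsConnected Ω) (hΩ_bdd : Bornology.IsBounded Ω)
    (lam q mu : ℝ) (hlam : 0 < lam) (hq0 : 0 < q) (hq1 : q < 1) (hmu0 : 0 < mu)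
    (hmu1 : mu < n)
    (u : EuclideanSpace ℝ (Fin n) → ℝ)
    (hu : Choquard.IsPositiveWeakSolution Ω lam q mu u) :
    ∀ p : ℝ, 1 ≤ p → MemLp u (ENNReal.ofReal p) (volume.restrict Ω) := by
  obtain ⟨hpos, G, ⟨⟨huL, hG, -⟩, φ₀, hφ₀, hl₁, hl₂⟩, hweak⟩ := hu
  intro s hs
  have hn' : (2 : ℝ) < n := by exact_mod_cast hn
  have hΩm := hΩ_open.measurableSet
  have hfin : IsFiniteMeasure (volume.restrict Ω) := ⟨by simpa using hΩ_bdd.measure_lt_top⟩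
  -- A subsequence of the approximants converges almost everywhere, as the nonlinear truncations
  -- require.
  obtain ⟨ns, hns, hae⟩ := (tendstoInMeasure_of_tendsto_eLpNorm (p := 2) (by simp)
    (fun k => (hφ₀ k).1.continuous.aestronglyMeasurable) huL.1 hl₁).exists_seq_tendsto_ae
  have hφ : ∀ k, Choquard.IsTestFunction Ω (φ₀ (ns k)) := fun k => hφ₀ _
  have hφL := hl₁.comp hns.tendsto_atTop
  have hφG := hl₂.comp hns.tendsto_atTop
  have hsob := Choquard.memLp_sobolev hn hφ hae huL.1 hG hφG
  -- A truly measurable representative of u, extended by zero, so that all potentials are integrals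
  -- over the whole space.
  let U : EuclideanSpace ℝ (Fin n) → ENNReal :=
    Ω.indicator fun x => ENNReal.ofReal (huL.1.mk u x)
  have hU : Measurable U :=
    (ENNReal.measurable_ofReal.comp huL.1.stronglyMeasurable_mk.measurable).indicator hΩm
  have hU0 : ∀ x ∉ Ω, U x = 0 := fun x hx => Set.indicator_of_notMem hx _
  have hUu : ∀ᵐ x ∂(volume.restrict Ω), U x = ENNReal.ofReal (u x) := by
    filter_upwards [huL.1.ae_eq_mk, ae_restrict_mem hΩm] with x hx hxΩ
    rw [hx]; exact Set.indicator_of_mem hxΩ _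
  have hUs : Choquard.lrNorm (2 * n / (n - 2)) U ≠ ⊤ :=
    (Choquard.lrNorm_ne_top_iff_memLp hpos huL.1 hU0 hUu
      (div_pos (by linarith) (by linarith))).2 hsob
  set p := Choquard.critExp n mu with hp
  have hp1 : 1 < p := Choquard.one_lt_critExp hn hmu1
  set F : EuclideanSpace ℝ (Fin n) → ENNReal := fun y =>
    Choquard.rieszPot mu (fun x => U x ^ p) y * U y ^ (p - 1) with hF
  have hFm : Measurable F := (Choquard.measurable_rieszPot mu (hU.pow_const p)).mul (hU.pow_const _)
  have hFint : ∫⁻ y, F y ≠ ⊤ :=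
    Choquard.lintegral_choquard_ne_top hn hmu0 hmu1 hΩ_open hΩ_bdd hU hU0 hUs
  have hN : IntegrableOn (fun y => (F y).toReal) Ω :=
    (integrable_toReal_of_lintegral_ne_top hFm.aemeasurable hFint).integrableOn
  have hN0 : ∀ᵐ y ∂(volume.restrict Ω), 0 ≤ (F y).toReal :=
    Eventually.of_forall fun y => ENNReal.toReal_nonneg
  have hweak' : ∀ ψ : EuclideanSpace ℝ (Fin n) → ℝ, Choquard.IsTestFunction Ω ψ →
      IntegrableOn (fun x => u x ^ (-q) * ψ x) Ω ∧
      (∫ x in Ω, (inner ℝ (G x) (gradient ψ x) - lam * u x ^ (-q) * ψ x))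
        - (∫ x in Ω, (F x).toReal * ψ x) = 0 := by
    intro ψ hψ
    obtain ⟨h1, h2⟩ := hweak ψ hψ
    rw [Choquard.integral_integral_choquard_eq hn hmu1 hpos huL.1 hU0 hUu] at h2
    exact ⟨h1, h2⟩
  have htest := fun ζ hζ hζ0 => Choquard.integral_cutoff_mul_inner_le hΩ_open hΩ_bdd hlam hq0 hq1
    hφ hae hpos hG hφG hN hN0 hweak' (ζ := ζ) hζ hζ0
  have hcP : Continuous Choquard.cutoffPrim := (Choquard.contDiff_cutoffPrim (m := 0)).continuous
  have hPint : IntegrableOn (fun x => Choquard.cutoffPrim (u x)) Ω := by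
    have huI : Integrable u (volume.restrict Ω) := huL.integrable (by norm_num)
    refine Integrable.mono huI (hcP.comp_aestronglyMeasurable huL.1)
      (Eventually.of_forall fun x => ?_)
    simpa [Choquard.cutoffPrim_zero] using Choquard.abs_cutoffPrim_sub_le (u x) 0
  obtain ⟨C, hC, hpt⟩ := Choquard.exists_ae_ofReal_le_rieszPot hn hΩ_open hΩ_bdd hPint
    (hpos.mono fun x hx => Choquard.cutoffPrim_nonneg hx.le)
    (g := fun y => lam + (F y).toReal) ((integrable_const lam).add hN)
    (Eventually.of_forall fun y => add_nonneg hlam.le ENNReal.toReal_nonneg)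
    (fun ε hε x => by
      rw [← Choquard.integral_cutoff_sq_mul_inner_regSq hΩ_open hΩ_bdd hφ hae huL hφL hG hφG hε x]
      exact Choquard.integral_cutoff_sq_mul_inner_le hΩ_open hΩ_bdd hlam hφ hae hpos huL.1 hG hφG
        hN hN0 htest (Choquard.contDiff_regSq_rpow hε x _)
        fun y => Real.rpow_nonneg (Choquard.regSq_pos hε x y).le _)
  set I : EuclideanSpace ℝ (Fin n) → ENNReal := Ω.indicator fun _ => ENNReal.ofReal lam with hI
  have hIm : Measurable I := measurable_const.indicator hΩm
  have hd : Module.finrank ℝ (EuclideanSpace ℝ (Fin n)) = n := finrank_euclideanSpace_fin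
  -- The constant λ on Ω has a bounded potential of order two, which joins the bounded term. The
  -- exponent t = n suffices since 1/n < 2/n.
  obtain ⟨B, hB, hIB⟩ := Choquard.exists_rieszPot_le_const (E := EuclideanSpace ℝ (Fin n))
    (a := (n : ℝ) - 2) (t := n) (by omega) (by linarith) (by linarith)
    (by rw [hd]; gcongr ?_ / _; linarith) hΩm hΩ_bdd.measure_lt_top.ne hIm
    (fun x hx => Set.indicator_of_notMem hx _)
    (Choquard.lrNorm_indicator_const_ne_top hΩm hΩ_bdd.measure_lt_top.ne ENNReal.ofReal_ne_top
      (by linarith))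
  have hle : ∀ᵐ x, U x ≤ Ω.indicator (fun _ => 3 + C * B) x
      + C * Choquard.rieszPot ((n : ℝ) - 2) F x := by
    have h1 := (ae_restrict_iff' hΩm).1 (hpos.and (hUu.and hpt))
    filter_upwards [h1] with x hx
    by_cases hxΩ : x ∈ Ω
    · obtain ⟨hx1, hx2, hx3⟩ := hx hxΩ
      rw [hx2, Set.indicator_of_mem hxΩ]
      have h2 : ∫⁻ y in Ω, ENNReal.ofReal (lam + (F y).toReal)
            * Choquard.rieszKernel (n - 2) (x - y)
          ≤ B + Choquard.rieszPot ((n : ℝ) - 2) F x := by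
        refine le_trans ?_ (add_le_add (hIB x) le_rfl)
        rw [← Choquard.rieszPot_add _ hIm, ← lintegral_indicator hΩm]
        refine lintegral_mono fun y => ?_
        by_cases hy : y ∈ Ω
        · rw [Set.indicator_of_mem hy, ENNReal.ofReal_add hlam.le ENNReal.toReal_nonneg]
          refine mul_le_mul_left (add_le_add ?_ ENNReal.ofReal_toReal_le) _
          simp only [hI, Set.indicator_of_mem hy, le_refl]
        · rw [Set.indicator_of_notMem hy]; exact zero_le
      calc ENNReal.ofReal (u x) ≤ ENNReal.ofReal (3 + Choquard.cutoffPrim (u x)) :=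
            ENNReal.ofReal_le_ofReal (Choquard.le_cutoffPrim_add hx1.le)
        _ ≤ 3 + C * (B + Choquard.rieszPot ((n : ℝ) - 2) F x) := by
            refine ENNReal.ofReal_add_le.trans (add_le_add (by simp) (hx3.trans ?_))
            gcongr
        _ = _ := by ring
    · rw [hU0 x hxΩ]; exact zero_le
  have hmain := Choquard.lrNorm_ne_top_of_le_choquard_all (E := EuclideanSpace ℝ (Fin n))
    (by omega) hmu0 (by rwa [hd]) (p := p) (by rw [hd]; exact Choquard.critExp_mul hn mu) hΩm
    hΩ_bdd.measure_lt_top.ne hU hU0 (by rwa [hd]) (C₀ := 3 + C * B) (by finiteness) hC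
    (by rw [hd]; exact hle) (s := s) (by linarith)
  exact (Choquard.lrNorm_ne_top_iff_memLp hpos huL.1 hU0 hUu (by linarith)).1 hmain
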